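/- Let $N$ be a smooth ($C^\infty$, Hausdorff, second countable) manifold of dimension $n$, let $n^+ + n^- = n$, and let $p_M\colon M\to N$ be the bundle of pseudo-Riemannian metrics of signature $(n^+,n^-)$ on $N$: its fibre over $x$ is the set of nondegenerate symmetric bilinear forms of signature $(n^+,n^-)$ on $T_xN$. Let $J^1M$ be the manifold of 1-jets $j^1_xg$ of local smooth sections $g$ of $p_M$, with projection $p^1_M\colon J^1M\to N$. Let $C^{\mathrm{sym}}\to N$ be the bundle of symmetric (torsion-free) linear connections, whose fibre over $x$ consists of the values $\Gamma_x$ at $x$ of symmetric linear connections $\Gamma$, and let $p\colon M\times_N C^{\mathrm{sym}}\to N$ be the projection of the fibre product. These spaces carry the smooth structures given by the coordinates $(x^i,y_{ij})$ on $M$, $(x^i,y_{ij},y_{ij,k})$ on $J^1M$ and $(x^i,y_{ij},A^i_{jk})$ on $M\times_N C^{\mathrm{sym}}$, where $y_{ij}$ are the components of a metric, $y_{ij,k}$ their first derivatives, and $A^i_{jk}=A^i_{kj}$ the Christoffel symbols of a connection. For a smooth fibred manifold $\pi\colon E\to N$ write $V(\pi)=\ker\pi_*\subset TE$. A (first-order)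 Ehresmann connection on $\pi$ is a smooth 1-form $\gamma$ on $E$ with values in $V(\pi)$ such that $\gamma(v)=v$ for every $v\in V(\pi)$. A second-order Ehresmann connection on $p_M\colon M\to N$ is a smooth 1-form $\gamma^2$ on $J^1M$ with values in $V(p^1_M)$ such that $\gamma^2(v)=v$ for every $v\in V(p^1_M)$. Then: 1. There is a well-defined map $\zeta_N\colon J^1M\to M\times_N C^{\mathrm{sym}}$ with $\zeta_N(j^1_xg)=(g_x,\Gamma^g_x)$ for every $x\in N$ and every metric $g$ of signature $(n^+,n^-)$ defined near $x$, where $\Gamma^g$ is the Levi-Civita connection of $g$, and $\zeta_N$ is a diffeomorphism. 2. The differential $(\zeta_N)_*\colon T(J^1M)\to T(M\times_N C^{\mathrm{sym}})$ restricts to isomorphisms $(\zeta_N^v)_*\colon V(p^1_M)_j\to V(p)_{\zeta_N(j)}$, $j\in J^1M$, of the vertical spaces, and $$\gamma\longmapsto\gamma^2=\big((\zeta_N^v)_*\big)^{-1}\circ\gamma\circ(\zeta_N)_*$$ is a bijection from the set of first-order Ehresmann connections on $p\colon M\times_N C^{\mathrm{sym}}\to N$ onto the set of second-order Ehresmann connections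 on $p_M\colon M\to N$. -/

import Mathlib

open Set Filter Bundle
open scoped Manifold ContDiff Topology

noncomputable section

/-- The model space `ℝⁿ`. -/
abbrev Model (n : ℕ) : Type := EuclideanSpace ℝ (Fin n)

/-- Fibred coordinates on a bundle `proj : X → N`: over the domain of each preferred chart of `N` a
coordinate `coord c` that maps each fibre bijectively onto a fixed open set `fib` of a normed space
`V`, with smooth transition functions `trans`. The first argument of `trans c c'` is the base
point in the chart at `c`. -/
structure FibreCoords (n : ℕ) (N : Type*) [TopologicalSpace N] [ChartedSpace (Model n) N]
    (V : Type*) [NormedAddCommGroup V] [NormedSpace ℝ V] (X : Type*) where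
  proj : X → N
  fib : Set V
  isOpen_fib : IsOpen fib
  coord : N → X → V
  bijOn : ∀ c y, y ∈ (chartAt (Model n) c).source → BijOn (coord c) (proj ⁻¹' {y}) fib
  trans : N → N → Model n × V → V
  coord_eq_trans : ∀ c c' e, proj e ∈ (chartAt (Model n) c).source →
    proj e ∈ (chartAt (Model n) c').source →
      coord c' e = trans c c' (chartAt (Model n) c (proj e), coord c e)
  contDiffOn_trans : ∀ c c', ContDiffOn ℝ ∞ (trans c c')
    (((chartAt (Model n) c).symm ≫ₕ chartAt (Model n) c').source ×ˢ fib)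

namespace FibreCoords

variable {n : ℕ} {N : Type*} [TopologicalSpace N] [ChartedSpace (Model n) N]
  {V : Type*} [NormedAddCommGroup V] [NormedSpace ℝ V] {X : Type*}

open Classical in
/-- The bundle chart `e ↦ (x, fibre coordinate)` over the chart of `N` at the base point of `e₀`. -/
def chart (F : FibreCoords n N V X) (e₀ : X) : PartialEquiv X (Model n × V) where
  toFun e := (chartAt (Model n) (F.proj e₀) (F.proj e), F.coord (F.proj e₀) e)
  source := F.proj ⁻¹' (chartAt (Model n) (F.proj e₀)).source
  target := (chartAt (Model n) (F.proj e₀)).target ×ˢ F.fib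
  invFun q := if h : ∃ e, F.proj e ∈ (chartAt (Model n) (F.proj e₀)).source ∧
      (chartAt (Model n) (F.proj e₀) (F.proj e), F.coord (F.proj e₀) e) = q then h.choose else e₀
  map_source' e he := ⟨(chartAt (Model n) (F.proj e₀)).map_source he,
    (F.bijOn _ _ he).mapsTo rfl⟩
  map_target' q hq := by
    have h : ∃ e, F.proj e ∈ (chartAt (Model n) (F.proj e₀)).source ∧
        (chartAt (Model n) (F.proj e₀) (F.proj e), F.coord (F.proj e₀) e) = q := by
      obtain ⟨e, he, hv⟩ := (F.bijOn _ _
        ((chartAt (Model n) (F.proj e₀)).map_target hq.1)).surjOn hq.2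
      have he' : F.proj e = _ := he
      refine ⟨e, ?_, ?_⟩
      · rw [he']; exact (chartAt (Model n) (F.proj e₀)).map_target hq.1
      · rw [he', (chartAt (Model n) (F.proj e₀)).right_inv hq.1, hv]
    rw [dif_pos h]
    exact h.choose_spec.1
  left_inv' e he := by
    have h : ∃ e', F.proj e' ∈ (chartAt (Model n) (F.proj e₀)).source ∧
        (chartAt (Model n) (F.proj e₀) (F.proj e'), F.coord (F.proj e₀) e') =
        (chartAt (Model n) (F.proj e₀) (F.proj e), F.coord (F.proj e₀) e) := ⟨e, he, rfl⟩
    rw [dif_pos h]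
    obtain ⟨h1, h2⟩ := h.choose_spec
    have hp : F.proj h.choose = F.proj e :=
      (chartAt (Model n) (F.proj e₀)).injOn h1 he (congrArg Prod.fst h2)
    exact (F.bijOn _ _ he).injOn hp rfl (congrArg Prod.snd h2)
  right_inv' q hq := by
    have h : ∃ e, F.proj e ∈ (chartAt (Model n) (F.proj e₀)).source ∧
        (chartAt (Model n) (F.proj e₀) (F.proj e), F.coord (F.proj e₀) e) = q := by
      obtain ⟨e, he, hv⟩ := (F.bijOn _ _
        ((chartAt (Model n) (F.proj e₀)).map_target hq.1)).surjOn hq.2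
      have he' : F.proj e = _ := he
      refine ⟨e, ?_, ?_⟩
      · rw [he']; exact (chartAt (Model n) (F.proj e₀)).map_target hq.1
      · rw [he', (chartAt (Model n) (F.proj e₀)).right_inv hq.1, hv]
    rw [dif_pos h]
    exact h.choose_spec.2

lemma chart_symm_proj (F : FibreCoords n N V X) (e₀ : X) {q : Model n × V}
    (hq : q ∈ (F.chart e₀).target) :
    F.proj ((F.chart e₀).symm q) = (chartAt (Model n) (F.proj e₀)).symm q.1 := by
  have h := congrArg Prod.fst ((F.chart e₀).right_inv hq)
  have h2 : F.proj ((F.chart e₀).symm q) ∈ (chartAt (Model n) (F.proj e₀)).source :=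
    (F.chart e₀).map_target hq
  change chartAt (Model n) (F.proj e₀) (F.proj ((F.chart e₀).symm q)) = q.1 at h
  rw [← h, (chartAt (Model n) (F.proj e₀)).left_inv h2]

lemma chart_symm_coord (F : FibreCoords n N V X) (e₀ : X) {q : Model n × V}
    (hq : q ∈ (F.chart e₀).target) :
    F.coord (F.proj e₀) ((F.chart e₀).symm q) = q.2 :=
  congrArg Prod.snd ((F.chart e₀).right_inv hq)

lemma trans_source (F : FibreCoords n N V X) (e₀ e₁ : X) :
    ((F.chart e₀).symm.trans (F.chart e₁)).source =
      ((chartAt (Model n) (F.proj e₀)).symm ≫ₕ chartAt (Model n) (F.proj e₁)).source ×ˢ F.fib := by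
  ext q
  constructor
  · rintro ⟨h1, h2⟩
    refine ⟨⟨h1.1, ?_⟩, h1.2⟩
    have h2 : F.proj ((F.chart e₀).symm q) ∈ (chartAt (Model n) (F.proj e₁)).source := h2
    rwa [F.chart_symm_proj e₀ h1] at h2
  · rintro ⟨⟨h1, h2⟩, h3⟩
    have h4 : q ∈ (F.chart e₀).target := ⟨h1, h3⟩
    refine ⟨h4, ?_⟩
    change F.proj ((F.chart e₀).symm q) ∈ (chartAt (Model n) (F.proj e₁)).source
    rw [F.chart_symm_proj e₀ h4]
    exact h2

lemma trans_eqOn (F : FibreCoords n N V X) (e₀ e₁ : X) :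
    EqOn ((F.chart e₀).symm.trans (F.chart e₁))
      (fun q => (chartAt (Model n) (F.proj e₁) ((chartAt (Model n) (F.proj e₀)).symm q.1),
        F.trans (F.proj e₀) (F.proj e₁) q))
      ((F.chart e₀).symm.trans (F.chart e₁)).source := by
  intro q hq
  have h2 : F.proj ((F.chart e₀).symm q) ∈ (chartAt (Model n) (F.proj e₁)).source := hq.2
  have h0 : F.proj ((F.chart e₀).symm q) ∈ (chartAt (Model n) (F.proj e₀)).source :=
    (F.chart e₀).map_target hq.1
  refine Prod.ext ?_ ?_
  · change chartAt (Model n) (F.proj e₁) (F.proj ((F.chart e₀).symm q)) = _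
    rw [F.chart_symm_proj e₀ hq.1]
  · change F.coord (F.proj e₁) ((F.chart e₀).symm q) = _
    rw [F.coord_eq_trans (F.proj e₀) (F.proj e₁) _ h0 h2, F.chart_symm_coord e₀ hq.1,
      F.chart_symm_proj e₀ hq.1, (chartAt (Model n) (F.proj e₀)).right_inv hq.1.1]

end FibreCoords

lemma contDiffOn_chart_change {n : ℕ} {N : Type*} [TopologicalSpace N] [ChartedSpace (Model n) N]
    [IsManifold (𝓡 n) ∞ N] (c c' : N) :
    ContDiffOn ℝ ∞ (fun u => chartAt (Model n) c' ((chartAt (Model n) c).symm u))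
      ((chartAt (Model n) c).symm ≫ₕ chartAt (Model n) c').source := by
  have h := contDiffOn_ext_coord_change (I := 𝓡 n) (n := ∞) c' c
  simpa [Function.comp_def, mfld_simps] using! h

namespace FibreCoords

variable {n : ℕ} {N : Type*} [TopologicalSpace N] [ChartedSpace (Model n) N]
  [IsManifold (𝓡 n) ∞ N]
  {V : Type*} [NormedAddCommGroup V] [NormedSpace ℝ V] {X : Type*}

lemma contDiffOn_chart_trans (F : FibreCoords n N V X) (e₀ e₁ : X) :
    ContDiffOn ℝ ∞ ((F.chart e₀).symm.trans (F.chart e₁))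
      ((F.chart e₀).symm.trans (F.chart e₁)).source := by
  refine ContDiffOn.congr ?_ (F.trans_eqOn e₀ e₁)
  rw [F.trans_source]
  exact ContDiffOn.prodMk ((contDiffOn_chart_change _ _).comp contDiffOn_fst (fun q hq => hq.1))
    (F.contDiffOn_trans _ _)

/-- The bundle charts form an atlas of `X`. -/
def core (F : FibreCoords n N V X) : ChartedSpaceCore (Model n × V) X where
  atlas := range F.chart
  chartAt := F.chart
  mem_chart_source e := mem_chart_source (Model n) (F.proj e)
  chart_mem_atlas e := ⟨e, rfl⟩
  open_source := by
    rintro _ _ ⟨e₀, rfl⟩ ⟨e₁, rfl⟩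
    rw [F.trans_source]
    exact (OpenPartialHomeomorph.open_source _).prod F.isOpen_fib
  continuousOn_toFun := by
    rintro _ _ ⟨e₀, rfl⟩ ⟨e₁, rfl⟩
    exact (F.contDiffOn_chart_trans e₀ e₁).continuousOn

/-- The total space `X`, with the topology and the smooth structure of the bundle charts. -/
def Total (_F : FibreCoords n N V X) : Type _ := X

instance (F : FibreCoords n N V X) : TopologicalSpace F.Total := F.core.toTopologicalSpace

instance (F : FibreCoords n N V X) : ChartedSpace (Model n × V) F.Total := F.core.toChartedSpace

instance (F : FibreCoords n N V X) : IsManifold 𝓘(ℝ, Model n × V) ∞ F.Total := by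
  apply isManifold_of_contDiffOn
  rintro e e' ⟨_, ⟨p, rfl⟩, he⟩ ⟨_, ⟨p', rfl⟩, he'⟩
  obtain ⟨⟨e₀, rfl⟩, rfl⟩ := mem_iUnion.1 he
  obtain ⟨⟨e₁, rfl⟩, rfl⟩ := mem_iUnion.1 he'
  simpa [mfld_simps] using! F.contDiffOn_chart_trans e₀ e₁

end FibreCoords

section Jets

variable {E H E' H' N X : Type*} [NormedAddCommGroup E] [NormedSpace ℝ E] [TopologicalSpace H]
  [NormedAddCommGroup E'] [NormedSpace ℝ E'] [TopologicalSpace H']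
  (I : ModelWithCorners ℝ E H) (J : ModelWithCorners ℝ E' H')
  [TopologicalSpace N] [ChartedSpace H N] [TopologicalSpace X] [ChartedSpace H' X]

/-- Smooth sections of `p : X → N` that are defined near `x` (values elsewhere are irrelevant). -/
structure LocalSection (p : X → N) (x : N) where
  toFun : N → X
  exists_nhds : ∃ U ∈ 𝓝 x, ContMDiffOn I J ∞ toFun U ∧ ∀ y ∈ U, p (toFun y) = y

/-- Two local sections have the same first-order jet at `x` if their differentials on the tangent
space at `x` agree (as maps into the tangent bundle of `X`, so their values at `x` agree, too). -/
instance LocalSection.jetSetoid (p : X → N) (x : N) : Setoid (LocalSection I J p x) where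
  r s s' := ∀ v : TangentSpace I x, tangentMap I J s.toFun ⟨x, v⟩ = tangentMap I J s'.toFun ⟨x, v⟩
  iseqv := ⟨fun _ _ => rfl, fun h v => (h v).symm, fun h h' v => (h v).trans (h' v)⟩

/-- The space of 1-jets of local sections of `p : X → N`. -/
structure Jet1 (p : X → N) where
  base : N
  cls : Quotient (LocalSection.jetSetoid I J p base)

variable {I J}

/-- The 1-jet at `x` of a local section. -/
def LocalSection.jet {p : X → N} {x : N} (s : LocalSection I J p x) : Jet1 I J p :=
  ⟨x, Quotient.mk _ s⟩

lemma LocalSection.toFun_eq_of_equiv {p : X → N} {x : N} {s s' : LocalSection I J p x}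
    (h : s ≈ s') : s.toFun x = s'.toFun x :=
  congrArg TotalSpace.proj (h 0)

/-- The value at `x` of a 1-jet at `x`. -/
def Jet1.value {p : X → N} (j : Jet1 I J p) : X :=
  Quotient.lift (fun s : LocalSection I J p j.base => s.toFun j.base)
    (fun _ _ h => LocalSection.toFun_eq_of_equiv h) j.cls

lemma LocalSection.mdifferentiableAt {p : X → N} {x : N} (s : LocalSection I J p x) :
    MDifferentiableAt I J s.toFun x := by
  obtain ⟨U, hU, h, -⟩ := s.exists_nhds
  exact (h.contMDiffAt hU).mdifferentiableAt (by simp)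

lemma LocalSection.eventually {p : X → N} {x : N} (s : LocalSection I J p x) :
    ∀ᶠ y in 𝓝 x, p (s.toFun y) = y := by
  obtain ⟨U, hU, -, h⟩ := s.exists_nhds
  filter_upwards [hU] with y hy using h y hy

lemma LocalSection.proj_self {p : X → N} {x : N} (s : LocalSection I J p x) :
    p (s.toFun x) = x := s.eventually.self_of_nhds

lemma tangentMap_congr {f g : N → X} {x : N} (h : f =ᶠ[𝓝 x] g) (v : TangentSpace I x) :
    tangentMap I J f ⟨x, v⟩ = tangentMap I J g ⟨x, v⟩ := by
  have h0 : f x = g x := h.self_of_nhds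
  have h1 : ∀ w : E, (mfderiv I J f x : E →L[ℝ] E') w = (mfderiv I J g x : E →L[ℝ] E') w := by
    intro w; rw [h.mfderiv_eq]; rfl
  have h2 : ∀ (a b : X) (w w' : E'), a = b → w = w' →
    (⟨a, w⟩ : TangentBundle J X) = ⟨b, w'⟩ := by rintro a b w w' rfl rfl; rfl
  exact h2 _ _ _ _ h0 (h1 v)

end Jets

namespace FibreCoords

variable {n : ℕ} {N : Type*} [TopologicalSpace N] [ChartedSpace (Model n) N]
  [IsManifold (𝓡 n) ∞ N]
  {V : Type*} [NormedAddCommGroup V] [NormedSpace ℝ V] {X : Type*}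

/-- The bundle projection. -/
def pr (F : FibreCoords n N V X) : F.Total → N := F.proj

/-- Local smooth sections of the bundle near `x`. -/
abbrev Sec (F : FibreCoords n N V X) (x : N) : Type _ :=
  LocalSection (𝓡 n) 𝓘(ℝ, Model n × V) F.pr x

/-- The coordinate representation of a section. -/
def rep (F : FibreCoords n N V X) (c : N) (s : N → F.Total) (u : Model n) : V :=
  F.coord c (s ((chartAt (Model n) c).symm u))

lemma extChartAt_eq (F : FibreCoords n N V X) (e₀ e : F.Total) :
    extChartAt 𝓘(ℝ, Model n × V) e₀ e =
      (chartAt (Model n) (F.pr e₀) (F.pr e), F.coord (F.pr e₀) e) := rfl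

lemma chartAt_source (F : FibreCoords n N V X) (e₀ : F.Total) :
    (chartAt (Model n × V) e₀).source = F.pr ⁻¹' (chartAt (Model n) (F.pr e₀)).source := rfl

lemma exists_over (F : FibreCoords n N V X) {c x : N} {s : N → F.Total} (h : F.pr (s x) = x)
    (hx : x ∈ (chartAt (Model n) c).source) : ∃ e₀ : F.Total, F.pr e₀ = c := by
  have h1 : F.coord c (s x) ∈ F.fib := (F.bijOn c x hx).mapsTo h
  obtain ⟨e, he, -⟩ := (F.bijOn c c (mem_chart_source _ c)).surjOn h1
  exact ⟨e, he⟩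

lemma mdifferentiableAt_chart (F : FibreCoords n N V X) {c : N} (e₀ e : F.Total)
    (hc : F.pr e₀ = c)
    (he : F.pr e ∈ (chartAt (Model n) c).source) :
    MDifferentiableAt 𝓘(ℝ, Model n × V) 𝓘(ℝ, Model n × V) (fun e : F.Total =>
      (chartAt (Model n) c (F.pr e), F.coord c e)) e := by
  subst hc
  exact mdifferentiableAt_extChartAt (I := 𝓘(ℝ, Model n × V)) (x := e₀) he

lemma mdifferentiableAt_coord (F : FibreCoords n N V X) {c : N} (e₀ e : F.Total)
    (hc : F.pr e₀ = c) (he : F.pr e ∈ (chartAt (Model n) c).source) :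
    MDifferentiableAt 𝓘(ℝ, Model n × V) 𝓘(ℝ, V) (fun e : F.Total => F.coord c e) e :=
  MDifferentiableAt.comp e
    (g := (ContinuousLinearMap.snd ℝ (Model n) V)) (ContinuousLinearMap.mdifferentiableAt _)
    (F.mdifferentiableAt_chart e₀ e hc he)

lemma tangentMap_chart_symm {c x : N} (hx : x ∈ (chartAt (Model n) c).source) (w : Model n) :
    ∃ v : TangentSpace (𝓡 n) x, tangentMap 𝓘(ℝ, Model n) (𝓡 n) (chartAt (Model n) c).symm
      ⟨chartAt (Model n) c x, w⟩ = ⟨x, v⟩ := by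
  have h : ∀ p : TangentBundle (𝓡 n) N, p.1 = x → ∃ v : TangentSpace (𝓡 n) x, p = ⟨x, v⟩ := by
    rintro ⟨y, v⟩ rfl; exact ⟨v, rfl⟩
  exact h _ ((chartAt (Model n) c).left_inv hx)

lemma mdifferentiableAt_chart_symm {c x : N} (hx : x ∈ (chartAt (Model n) c).source) :
    MDifferentiableAt 𝓘(ℝ, Model n) (𝓡 n) (chartAt (Model n) c).symm (chartAt (Model n) c x) :=
  mdifferentiableAt_atlas_symm (I := 𝓡 n) (chart_mem_atlas _ c)
    ((chartAt (Model n) c).map_source hx)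

lemma mdifferentiableAt_rep (F : FibreCoords n N V X) {c x : N} (s : F.Sec x)
    (hx : x ∈ (chartAt (Model n) c).source) :
    MDifferentiableAt 𝓘(ℝ, Model n) 𝓘(ℝ, V) (F.rep c s.toFun) (chartAt (Model n) c x) := by
  obtain ⟨e₀, he₀⟩ := F.exists_over s.proj_self hx
  have hl := (chartAt (Model n) c).left_inv hx
  have h1 := mdifferentiableAt_chart_symm hx
  have h2 := s.mdifferentiableAt
  have h3 := F.mdifferentiableAt_coord e₀ (s.toFun x) he₀ (by rwa [s.proj_self])
  have hl' : ∀ y, y = x → MDifferentiableAt (𝓡 n) 𝓘(ℝ, Model n × V) s.toFun y := by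
    rintro _ rfl; exact h2
  have h2 := hl' _ hl
  have h4 := h2.comp _ h1
  have hl'' : ∀ y, y = x → MDifferentiableAt 𝓘(ℝ, Model n × V) 𝓘(ℝ, V)
      (fun e : F.Total => F.coord c e) (s.toFun y) := by
    rintro _ rfl; exact h3
  have h3 := hl'' _ hl 
  exact MDifferentiableAt.comp (chartAt (Model n) c x) h3 h4

lemma differentiableAt_rep (F : FibreCoords n N V X) {c x : N} (s : F.Sec x)
    (hx : x ∈ (chartAt (Model n) c).source) :
    DifferentiableAt ℝ (F.rep c s.toFun) (chartAt (Model n) c x) :=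
  (F.mdifferentiableAt_rep s hx).differentiableAt

lemma fderiv_rep_congr (F : FibreCoords n N V X) {c x : N} {s s' : F.Sec x}
    (hx : x ∈ (chartAt (Model n) c).source) (h : s ≈ s') :
    fderiv ℝ (F.rep c s.toFun) (chartAt (Model n) c x) =
      fderiv ℝ (F.rep c s'.toFun) (chartAt (Model n) c x) := by
  obtain ⟨e₀, he₀⟩ := F.exists_over s.proj_self hx
  have hl := (chartAt (Model n) c).left_inv hx
  have key : ∀ (s : F.Sec x) (w : Model n),
      (tangentMap 𝓘(ℝ, Model n) 𝓘(ℝ, V) (F.rep c s.toFun) ⟨chartAt (Model n) c x, w⟩) =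
      tangentMap 𝓘(ℝ, Model n × V) 𝓘(ℝ, V) (fun e : F.Total => F.coord c e)
        (tangentMap (𝓡 n) 𝓘(ℝ, Model n × V) s.toFun
          (tangentMap 𝓘(ℝ, Model n) (𝓡 n) (chartAt (Model n) c).symm
            ⟨chartAt (Model n) c x, w⟩)) := by
    intro s w
    have h1 := mdifferentiableAt_chart_symm hx
    have h2 := s.mdifferentiableAt
    have h3 := F.mdifferentiableAt_coord e₀ (s.toFun x) he₀ (by rwa [s.proj_self])
    have hl' : ∀ y, y = x → MDifferentiableAt (𝓡 n) 𝓘(ℝ, Model n × V) s.toFun y := by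
      rintro _ rfl; exact h2
    have h2 := hl' _ hl
    have h4 := h2.comp _ h1
    have hl'' : ∀ y, y = x → MDifferentiableAt 𝓘(ℝ, Model n × V) 𝓘(ℝ, V)
        (fun e : F.Total => F.coord c e) (s.toFun y) := by
      rintro _ rfl; exact h3
    have h3 := hl'' _ hl
    rw [← tangentMap_comp_at (⟨chartAt (Model n) c x, w⟩ : TangentBundle 𝓘(ℝ, Model n) (Model n)) h2 h1,
      ← tangentMap_comp_at (⟨chartAt (Model n) c x, w⟩ : TangentBundle 𝓘(ℝ, Model n) (Model n)) h3 h4]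
    rfl
  ext1 w
  obtain ⟨v, hv⟩ := tangentMap_chart_symm hx w
  have e := key s w
  rw [hv, h v, ← hv, ← key s' w] at e
  have e2 : ∀ (a b : V) (w w' : V), (⟨a, w⟩ : TangentBundle 𝓘(ℝ, V) V) = ⟨b, w'⟩ → w = w' := by
    intro a b w w' h; cases h; rfl
  have e3 := e2 _ _ _ _ e
  rwa [mfderiv_eq_fderiv, mfderiv_eq_fderiv] at e3

lemma equiv_of_rep (F : FibreCoords n N V X) {c x : N} {s s' : F.Sec x}
    (hx : x ∈ (chartAt (Model n) c).source) (h0 : F.coord c (s.toFun x) = F.coord c (s'.toFun x))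
    (h : fderiv ℝ (F.rep c s.toFun) (chartAt (Model n) c x) =
      fderiv ℝ (F.rep c s'.toFun) (chartAt (Model n) c x)) : s ≈ s' := by
  obtain ⟨e₀, he₀⟩ := F.exists_over s.proj_self hx
  have hl := (chartAt (Model n) c).left_inv hx
  have hφ : MDifferentiableAt (𝓡 n) 𝓘(ℝ, Model n) (chartAt (Model n) c) x :=
    mdifferentiableAt_atlas (I := 𝓡 n) (chart_mem_atlas _ c) hx
  subst he₀
  set c := F.pr e₀ with hc
  have key : ∀ (s : F.Sec x) (v : TangentSpace (𝓡 n) x),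
      tangentMap (𝓡 n) 𝓘(ℝ, Model n × V) s.toFun ⟨x, v⟩ =
      tangentMap 𝓘(ℝ, Model n × V) 𝓘(ℝ, Model n × V) (chartAt (Model n × V) e₀).symm
        (tangentMap 𝓘(ℝ, Model n) 𝓘(ℝ, Model n × V) (fun u => (u, F.rep c s.toFun u))
          (tangentMap (𝓡 n) 𝓘(ℝ, Model n) (chartAt (Model n) c) ⟨x, v⟩)) := by
    intro s v
    have hev : s.toFun =ᶠ[𝓝 x] (chartAt (Model n × V) e₀).symm ∘
        ((fun u => (u, F.rep c s.toFun u)) ∘ (chartAt (Model n) c)) := by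
      filter_upwards [s.eventually, (chartAt (Model n) c).open_source.mem_nhds hx] with y hy hy'
      have h1 : s.toFun y ∈ (chartAt (Model n × V) e₀).source := by
        rw [F.chartAt_source]; change F.pr (s.toFun y) ∈ (chartAt (Model n) c).source; rwa [hy]
      rw [← (chartAt (Model n × V) e₀).left_inv h1]
      congr 1
      change (chartAt (Model n) c (F.pr (s.toFun y)), F.coord c (s.toFun y)) = _
      simp only [hy, Function.comp, rep, (chartAt (Model n) c).left_inv hy']
    have hr : MDifferentiableAt 𝓘(ℝ, Model n) 𝓘(ℝ, Model n × V)
        (fun u => (u, F.rep c s.toFun u)) (chartAt (Model n) c x) :=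
      (differentiableAt_id.prodMk (F.differentiableAt_rep s hx)).mdifferentiableAt
    have hs : MDifferentiableAt 𝓘(ℝ, Model n × V) 𝓘(ℝ, Model n × V)
        (chartAt (Model n × V) e₀).symm
        (((fun u => (u, F.rep c s.toFun u)) ∘ (chartAt (Model n) c)) x) := by
      refine mdifferentiableAt_atlas_symm (chart_mem_atlas _ e₀) ?_
      refine ⟨(chartAt (Model n) c).map_source hx, ?_⟩
      change F.coord c (s.toFun ((chartAt (Model n) c).symm (chartAt (Model n) c x))) ∈ _
      rw [hl]
      exact (F.bijOn c x hx).mapsTo s.proj_self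
    rw [tangentMap_congr hev, tangentMap_comp_at _ hs (hr.comp _ hφ), tangentMap_comp_at _ hr hφ]
  intro v
  rw [key s, key s']
  congr 1
  have e2 : ∀ (a b : Model n × V) (w w' : Model n × V), a = b → w = w' →
    (⟨a, w⟩ : TangentBundle 𝓘(ℝ, Model n × V) (Model n × V)) = ⟨b, w'⟩ := by
      rintro a b w w' rfl rfl; rfl
  apply e2
  · change (_, F.coord c (s.toFun ((chartAt (Model n) c).symm (chartAt (Model n) c x)))) =
      (_, F.coord c (s'.toFun ((chartAt (Model n) c).symm (chartAt (Model n) c x))))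
    rw [hl, h0]
  · have hr : ∀ s : F.Sec x, (mfderiv 𝓘(ℝ, Model n) 𝓘(ℝ, Model n × V)
        (fun u => (u, F.rep c s.toFun u)) (chartAt (Model n) c x) : Model n →L[ℝ] Model n × V) =
        (ContinuousLinearMap.id ℝ _).prod (fderiv ℝ (F.rep c s.toFun) (chartAt (Model n) c x)) := by
      intro s
      rw [mfderiv_eq_fderiv]
      exact ((hasFDerivAt_id _).prodMk (F.differentiableAt_rep s hx).hasFDerivAt).fderiv
    have := (hr s).trans ((by rw [h]) : _ = _) |>.trans (hr s').symm
    exact congrArg (fun A : Model n →L[ℝ] Model n × V =>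
      A (mfderiv (𝓡 n) 𝓘(ℝ, Model n) (chartAt (Model n) c) x v)) this

end FibreCoords

namespace FibreCoords

variable {n : ℕ} {N : Type*} [TopologicalSpace N] [ChartedSpace (Model n) N]
  [IsManifold (𝓡 n) ∞ N]
  {V : Type*} [NormedAddCommGroup V] [NormedSpace ℝ V] {X : Type*}

/-- The 1-jets of local smooth sections of the bundle. -/
abbrev Jet (F : FibreCoords n N V X) : Type _ := Jet1 (𝓡 n) 𝓘(ℝ, Model n × V) F.pr

open Classical in
/-- The standard fibre coordinates of a 1-jet: the value and the first derivatives of the coordinate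
representation of a section. -/
def jetCoord (F : FibreCoords n N V X) (c : N) (j : F.Jet) : V × (Model n →L[ℝ] V) :=
  (F.coord c j.value, if h : j.base ∈ (chartAt (Model n) c).source then
    Quotient.lift (fun s : F.Sec j.base =>
      fderiv ℝ (F.rep c s.toFun) (chartAt (Model n) c j.base))
      (fun _ _ hs => F.fderiv_rep_congr h hs) j.cls else 0)

lemma jetCoord_jet (F : FibreCoords n N V X) {c x : N} (s : F.Sec x)
    (hx : x ∈ (chartAt (Model n) c).source) :
    F.jetCoord c s.jet = (F.coord c (s.toFun x),
      fderiv ℝ (F.rep c s.toFun) (chartAt (Model n) c x)) :=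
  Prod.ext rfl (dif_pos hx)

/-- The change of the standard coordinates on 1-jets. -/
def jetTrans (F : FibreCoords n N V X) (c c' : N) (q : Model n × (V × (Model n →L[ℝ] V))) :
    V × (Model n →L[ℝ] V) :=
  (F.trans c c' (q.1, q.2.1),
    ((fderiv ℝ (F.trans c c') (q.1, q.2.1)).comp
      ((ContinuousLinearMap.id ℝ (Model n)).prod q.2.2)).comp
      (fderiv ℝ (fun u => chartAt (Model n) c ((chartAt (Model n) c').symm u))
        (chartAt (Model n) c' ((chartAt (Model n) c).symm q.1))))

lemma jet_ind (F : FibreCoords n N V X) {P : F.Jet → Prop}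
    (h : ∀ (x : N) (s : F.Sec x), P s.jet) (j : F.Jet) : P j := by
  obtain ⟨x, q⟩ := j
  induction q using Quotient.inductionOn with
  | h s => exact h x s

lemma jetCoord_eq_trans (F : FibreCoords n N V X) {c c' x : N} (s : F.Sec x)
    (hx : x ∈ (chartAt (Model n) c).source) (hx' : x ∈ (chartAt (Model n) c').source) :
    F.jetCoord c' s.jet = F.jetTrans c c' (chartAt (Model n) c x, F.jetCoord c s.jet) := by
  rw [F.jetCoord_jet s hx, F.jetCoord_jet s hx']
  have hl := (chartAt (Model n) c).left_inv hx
  have hl' := (chartAt (Model n) c').left_inv hx'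
  refine Prod.ext ?_ ?_
  · have h := F.coord_eq_trans c c' (s.toFun x) (by change F.pr (s.toFun x) ∈ (chartAt (Model n) c).source; rwa [s.proj_self])
      (by change F.pr (s.toFun x) ∈ (chartAt (Model n) c').source; rwa [s.proj_self])
    have hp : F.proj (s.toFun x) = x := s.proj_self
    rw [hp] at h
    exact h
  · simp only [jetTrans, hl]
    set ψ : Model n → Model n := fun u => chartAt (Model n) c ((chartAt (Model n) c').symm u)
    have hψx : ψ (chartAt (Model n) c' x) = chartAt (Model n) c x := by simp only [ψ, hl']
    have hopen : IsOpen ((chartAt (Model n) c').symm ≫ₕ chartAt (Model n) c).source :=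
      OpenPartialHomeomorph.open_source _
    have hmem : chartAt (Model n) c' x ∈
        ((chartAt (Model n) c').symm ≫ₕ chartAt (Model n) c).source :=
      ⟨(chartAt (Model n) c').map_source hx', by simpa [hl'] using hx⟩
    have hmem' : chartAt (Model n) c x ∈
        ((chartAt (Model n) c).symm ≫ₕ chartAt (Model n) c').source :=
      ⟨(chartAt (Model n) c).map_source hx, by simpa [hl] using hx'⟩
    have hψ : HasFDerivAt ψ (fderiv ℝ ψ (chartAt (Model n) c' x)) (chartAt (Model n) c' x) :=
      (((contDiffOn_chart_change c' c).contDiffAt (hopen.mem_nhds hmem)).differentiableAt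
        (by simp)).hasFDerivAt
    have hr := (F.differentiableAt_rep s hx).hasFDerivAt
    have ht : HasFDerivAt (F.trans c c') _ (chartAt (Model n) c x, F.coord c (s.toFun x)) :=
      (((F.contDiffOn_trans c c').contDiffAt
        (((OpenPartialHomeomorph.open_source _).prod F.isOpen_fib).mem_nhds
          ⟨hmem', (F.bijOn c x hx).mapsTo s.proj_self⟩)).differentiableAt
        (by simp)).hasFDerivAt
    have hc1 : HasFDerivAt (fun u => (u, F.rep c s.toFun u)) _ (chartAt (Model n) c x) :=
      (hasFDerivAt_id _).prodMk hr
    have hrx : F.rep c s.toFun (chartAt (Model n) c x) = F.coord c (s.toFun x) := by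
      simp only [rep, hl]
    rw [← hψx] at hc1
    have hc2 := hc1.comp _ hψ
    have ht' : HasFDerivAt (F.trans c c') (fderiv ℝ (F.trans c c')
        (chartAt (Model n) c x, F.coord c (s.toFun x)))
        (((fun u => (u, F.rep c s.toFun u)) ∘ ψ) (chartAt (Model n) c' x)) := by
      simpa only [Function.comp, hψx, hrx] using ht
    have hc3 := ht'.comp _ hc2
    have hev : F.rep c' s.toFun =ᶠ[𝓝 (chartAt (Model n) c' x)]
        (F.trans c c') ∘ ((fun u => (u, F.rep c s.toFun u)) ∘ ψ) := by
      have hcont : Tendsto (chartAt (Model n) c').symm (𝓝 (chartAt (Model n) c' x)) (𝓝 x) := by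
        have := (chartAt (Model n) c').continuousAt_symm ((chartAt (Model n) c').map_source hx')
        rwa [ContinuousAt, hl'] at this
      filter_upwards [hopen.mem_nhds hmem, hcont.eventually s.eventually] with u hu hs
      have hs' : F.proj (s.toFun ((chartAt (Model n) c').symm u)) =
        (chartAt (Model n) c').symm u := hs
      have h := F.coord_eq_trans c c' (s.toFun ((chartAt (Model n) c').symm u))
        (by rw [hs']; exact hu.2)
        (by rw [hs']; exact (chartAt (Model n) c').map_target hu.1)
      rw [hs'] at h
      simp only [rep, Function.comp, ψ]
      have hu2 : (chartAt (Model n) c').symm u ∈ (chartAt (Model n) c).source := hu.2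
      rw [(chartAt (Model n) c).left_inv hu2]
      exact h
    rw [hev.fderiv_eq, hc3.fderiv, hψx]
    rfl

lemma contDiffOn_jetTrans (F : FibreCoords n N V X) (c c' : N) :
    ContDiffOn ℝ ∞ (F.jetTrans c c') (((chartAt (Model n) c).symm ≫ₕ chartAt (Model n) c').source ×ˢ
      (F.fib ×ˢ univ)) := by
  have hopen : IsOpen (((chartAt (Model n) c).symm ≫ₕ chartAt (Model n) c').source ×ˢ F.fib) :=
    (OpenPartialHomeomorph.open_source _).prod F.isOpen_fib
  have hopen' : IsOpen ((chartAt (Model n) c').symm ≫ₕ chartAt (Model n) c).source :=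
    OpenPartialHomeomorph.open_source _
  have h1 : ContDiffOn ℝ ∞ (fun q : Model n × (V × (Model n →L[ℝ] V)) => (q.1, q.2.1))
    (((chartAt (Model n) c).symm ≫ₕ chartAt (Model n) c').source ×ˢ
      (F.fib ×ˢ univ)) := by fun_prop
  have hm : MapsTo (fun q : Model n × (V × (Model n →L[ℝ] V)) => (q.1, q.2.1))
      (((chartAt (Model n) c).symm ≫ₕ chartAt (Model n) c').source ×ˢ (F.fib ×ˢ univ))
      (((chartAt (Model n) c).symm ≫ₕ chartAt (Model n) c').source ×ˢ F.fib) :=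
    fun q hq => ⟨hq.1, hq.2.1⟩
  refine ((F.contDiffOn_trans c c').comp h1 hm).prodMk ?_
  refine ContDiffOn.clm_comp (ContDiffOn.clm_comp ?_ ?_) ?_
  · exact ((F.contDiffOn_trans c c').fderiv_of_isOpen hopen (by simp)).comp h1 hm
  · have : ∀ L : Model n →L[ℝ] V, (ContinuousLinearMap.id ℝ (Model n)).prod L =
        ContinuousLinearMap.inl ℝ (Model n) V + (ContinuousLinearMap.inr ℝ (Model n) V).comp L := by
      intro L; ext <;> simp
    simp only [this]
    fun_prop
  · have hd := (contDiffOn_chart_change c' c).fderiv_of_isOpen (m := ∞) hopen' (by simp)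
    refine hd.comp (t := ((chartAt (Model n) c').symm ≫ₕ chartAt (Model n) c).source)
      ((contDiffOn_chart_change c c').comp contDiffOn_fst (fun q hq => hq.1)) ?_
    rintro q ⟨⟨h1, h2⟩, -⟩
    refine ⟨(chartAt (Model n) c').map_source h2, ?_⟩
    change (chartAt (Model n) c').symm (chartAt (Model n) c' ((chartAt (Model n) c).symm q.1)) ∈
      (chartAt (Model n) c).source
    have h2 : (chartAt (Model n) c).symm q.1 ∈ (chartAt (Model n) c').source := h2
    rw [(chartAt (Model n) c').left_inv h2]
    exact (chartAt (Model n) c).map_target h1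

lemma bijOn_jetCoord (F : FibreCoords n N V X) (c y : N)
    (hy : y ∈ (chartAt (Model n) c).source) :
    BijOn (F.jetCoord c) (Jet1.base ⁻¹' {y}) (F.fib ×ˢ univ) := by
  refine ⟨?_, ?_, ?_⟩
  · intro j hj
    induction j using F.jet_ind with
    | h x s =>
      obtain rfl : x = y := hj
      rw [F.jetCoord_jet s hy]
      exact ⟨(F.bijOn c x hy).mapsTo s.proj_self, mem_univ _⟩
  · intro j hj j' hj' hjj
    induction j using F.jet_ind with
    | h x s =>
    induction j' using F.jet_ind with
    | h x' s' =>
      obtain rfl : x = y := hj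
      obtain rfl : x' = x := hj'
      rw [F.jetCoord_jet s hy, F.jetCoord_jet s' hy] at hjj
      have := F.equiv_of_rep hy (congrArg Prod.fst hjj) (congrArg Prod.snd hjj)
      exact congrArg (Jet1.mk x') (Quotient.sound this)
  · rintro ⟨v, L⟩ ⟨hv, -⟩
    obtain ⟨e₀, he₀⟩ : ∃ e₀ : F.Total, F.pr e₀ = c := by
      obtain ⟨e₀, he₀, -⟩ := (F.bijOn c c (mem_chart_source _ c)).surjOn hv
      exact ⟨e₀, he₀⟩
    subst he₀
    set c : N := F.pr e₀
    let f : Model n → Model n × V := fun u => (u, v + L (u - chartAt (Model n) c y))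
    have hf : Continuous f := by fun_prop
    have hfs : ContDiff ℝ ∞ f := by fun_prop
    have hopen : IsOpen (f ⁻¹' (chartAt (Model n × V) e₀).target) :=
      (chartAt (Model n × V) e₀).open_target.preimage hf
    have hy' : f (chartAt (Model n) c y) ∈ (chartAt (Model n × V) e₀).target := by
      refine ⟨(chartAt (Model n) c).map_source hy, ?_⟩
      simpa [f] using hv
    let U : Set N := (chartAt (Model n) c).source ∩
      (chartAt (Model n) c) ⁻¹' (f ⁻¹' (chartAt (Model n × V) e₀).target)
    have hU : U ∈ 𝓝 y := ((chartAt (Model n) c).isOpen_inter_preimage hopen).mem_nhds ⟨hy, hy'⟩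
    let s : F.Sec y :=
      { toFun := fun z => (chartAt (Model n × V) e₀).symm (f (chartAt (Model n) c z))
        exists_nhds := by
          refine ⟨U, hU, ?_, ?_⟩
          · have h1 := contMDiffOn_chart_symm (I := 𝓘(ℝ, Model n × V)) (n := ∞) (x := e₀)
            have h2 := contMDiffOn_chart (I := 𝓡 n) (n := ∞) (x := c)
            exact h1.comp ((hfs.contMDiff.comp_contMDiffOn h2).mono inter_subset_left)
              (fun z hz => hz.2)
          · intro z hz
            exact (F.chart_symm_proj e₀ hz.2).trans ((chartAt (Model n) c).left_inv hz.1) }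
    refine ⟨s.jet, rfl, ?_⟩
    rw [F.jetCoord_jet s hy]
    have hev : F.rep c s.toFun =ᶠ[𝓝 (chartAt (Model n) c y)] fun u => (f u).2 := by
      filter_upwards [hopen.mem_nhds hy'] with u hu
      change F.coord c ((F.chart e₀).symm (f (chartAt (Model n) c ((chartAt (Model n) c).symm u)))) = _
      rw [(chartAt (Model n) c).right_inv hu.1]
      exact F.chart_symm_coord e₀ hu
    have hfd : HasFDerivAt (fun u => (f u).2) L (chartAt (Model n) c y) := by
      have h := (L.hasFDerivAt.comp (chartAt (Model n) c y) ((hasFDerivAt_id (chartAt (Model n) c y)).sub_const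
        (chartAt (Model n) c y))).const_add v
      exact h
    refine Prod.ext ?_ ?_
    · have := hev.self_of_nhds
      simpa [rep, (chartAt (Model n) c).left_inv hy, f] using this
    · exact hev.fderiv_eq.trans hfd.fderiv

/-- The first jet bundle over `N`, with its standard coordinates. -/
def jetCoords (F : FibreCoords n N V X) : FibreCoords n N (V × (Model n →L[ℝ] V)) F.Jet where
  proj := Jet1.base
  fib := F.fib ×ˢ univ
  isOpen_fib := F.isOpen_fib.prod isOpen_univ
  coord := F.jetCoord
  bijOn := F.bijOn_jetCoord
  trans := F.jetTrans
  coord_eq_trans _ _ := F.jet_ind (fun _ s h h' => F.jetCoord_eq_trans s h h')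
  contDiffOn_trans := F.contDiffOn_jetTrans

end FibreCoords

section Conn
variable {n : ℕ} {N : Type*} [TopologicalSpace N] [ChartedSpace (Model n) N]

/-- Vector fields on `N`, without any regularity. -/
abbrev VField (n : ℕ) (N : Type*) [TopologicalSpace N] [ChartedSpace (Model n) N] : Type _ :=
  Π y : N, TangentSpace (𝓡 n) y

variable [IsManifold (𝓡 n) ∞ N]

/-- Differentiability of a vector field at a point. -/
def VField.DiffAt (Y : VField n N) (x : N) : Prop :=
  MDifferentiableAt (𝓡 n) (𝓡 n).tangent (fun y => (⟨y, Y y⟩ : TangentBundle (𝓡 n) N)) x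

/-- The values at `x` of symmetric (torsion-free) linear connections on `N`: the operators
`Y ↦ (w ↦ ∇_w Y)` at `x`, on the vector fields that are differentiable at `x`, that are additive
and satisfy the Leibniz rule and `∇_Y Z - ∇_Z Y = [Y, Z]`. Fields that are not differentiable at
`x` get the value `0`. -/
structure SymConnAt (x : N) where
  toFun : VField n N → (TangentSpace (𝓡 n) x →L[ℝ] TangentSpace (𝓡 n) x)
  add : ∀ Y Z : VField n N, Y.DiffAt x → Z.DiffAt x →
    toFun (Y + Z) = toFun Y + toFun Z
  leibniz : ∀ (f : N → ℝ) (Y : VField n N), MDifferentiableAt (𝓡 n) 𝓘(ℝ, ℝ) f x → Y.DiffAt x →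
    toFun (f • Y) = f x • toFun Y + (mvfderiv (𝓡 n) f x).smulRight (Y x)
  torsion_free : ∀ Y Z : VField n N, Y.DiffAt x → Z.DiffAt x →
    toFun Z (Y x) - toFun Y (Z x) = VectorField.mlieBracket (𝓡 n) Y Z x
  junk : ∀ Y : VField n N, ¬ Y.DiffAt x → toFun Y = 0

/-- Components of a tangent vector at `y` in the chart at `c`. -/
def toModel (c y : N) : TangentSpace (𝓡 n) y →L[ℝ] Model n :=
  (trivializationAt (Model n) (TangentSpace (𝓡 n)) c).continuousLinearMapAt ℝ y

/-- The tangent vector at `y` with given components in the chart at `c`. -/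
def ofModel (c y : N) : Model n →L[ℝ] TangentSpace (𝓡 n) y :=
  (trivializationAt (Model n) (TangentSpace (𝓡 n)) c).symmL ℝ y

lemma toModel_ofModel {c y : N} (hy : y ∈ (chartAt (Model n) c).source) (v : Model n) :
    toModel c y (ofModel c y v) = v :=
  Trivialization.continuousLinearMapAt_symmL _ hy v

lemma ofModel_toModel {c y : N} (hy : y ∈ (chartAt (Model n) c).source)
    (v : TangentSpace (𝓡 n) y) : ofModel c y (toModel c y v) = v :=
  Trivialization.symmL_continuousLinearMapAt _ hy v

lemma VField.diffAt_iff {c x : N} (hx : x ∈ (chartAt (Model n) c).source)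
    (Y : VField n N) :
    Y.DiffAt x ↔ MDifferentiableAt (𝓡 n) 𝓘(ℝ, Model n) (fun y => toModel c y (Y y)) x := by
  rw [VField.DiffAt,
    (trivializationAt (Model n) (TangentSpace (𝓡 n)) c).mdifferentiableAt_section_iff (𝓡 n) Y hx]
  refine EventuallyEq.mdifferentiableAt_iff ?_
  filter_upwards [(chartAt (Model n) c).open_source.mem_nhds hx] with y hy
  exact (congrFun ((trivializationAt (Model n) (TangentSpace (𝓡 n)) c).coe_linearMapAt_of_mem (R := ℝ) hy)
    (Y y)).symm

/-- The vector field with constant components `v` in the chart at `c`. -/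
def coordField (c : N) (v : Model n) : VField n N := fun y => ofModel c y v

lemma diffAt_coordField {c x : N} (hx : x ∈ (chartAt (Model n) c).source) (v : Model n) :
    (coordField c v).DiffAt x := by
  rw [VField.diffAt_iff hx]
  refine (mdifferentiableAt_const (c := v)).congr_of_eventuallyEq ?_
  filter_upwards [(chartAt (Model n) c).open_source.mem_nhds hx] with y hy
  exact toModel_ofModel hy v

/-- The derivative of the change from the chart at `c'` to the chart at `c`, at the point with
coordinate `u` in the chart at `c`. -/
def coordChg (c c' : N) (u : Model n) : Model n →L[ℝ] Model n :=
  fderiv ℝ (fun w => chartAt (Model n) c ((chartAt (Model n) c').symm w))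
    (chartAt (Model n) c' ((chartAt (Model n) c).symm u))

lemma toModel_ofModel_eq {c c' y : N} (hy : y ∈ (chartAt (Model n) c).source)
    (hy' : y ∈ (chartAt (Model n) c').source) (v : Model n) :
    toModel c y (ofModel c' y v) = coordChg c c' (chartAt (Model n) c y) v := by
  have h1 : toModel (n := n) c y = tangentCoordChange (𝓡 n) y c y :=
    TangentBundle.continuousLinearMapAt_trivializationAt_eq_core hy
  have h2 : ofModel (n := n) c' y = tangentCoordChange (𝓡 n) c' y y :=
    TangentBundle.symmL_trivializationAt_eq_core hy'
  rw [h1, h2]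
  have := tangentCoordChange_comp (I := 𝓡 n) (w := c') (x := y) (y := c) (z := y) (v := v)
    (by simp [hy, hy'])
  refine this.trans ?_
  rw [tangentCoordChange_def, coordChg, (chartAt (Model n) c).left_inv hy]
  simp [Function.comp_def, mfld_simps]

lemma mlieBracket_coordField {c x : N} (hx : x ∈ (chartAt (Model n) c).source) (u v : Model n) :
    VectorField.mlieBracket (𝓡 n) (coordField c u : VField n N) (coordField c v) x = 0 := by
  obtain ⟨W, hW⟩ : ∃ W : Model n → ∀ z : Model n, TangentSpace 𝓘(ℝ, Model n) z,
      ∀ v z, W v z = v := ⟨fun v _ => v, fun _ _ => rfl⟩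
  have : IsManifold (𝓡 n) (minSmoothness ℝ 2) N := IsManifold.of_le (n := ∞) (by
    rw [minSmoothness_of_isRCLikeNormedField]; exact ENat.LEInfty.out)
  have key : ∀ v : Model n, ∀ᶠ y in 𝓝 x, coordField c v y =
      VectorField.mpullback (𝓡 n) 𝓘(ℝ, Model n) (extChartAt (𝓡 n) c)
        (W v) y := by
    intro v
    filter_upwards [(chartAt (Model n) c).open_source.mem_nhds hx] with y hy
    rw [VectorField.mpullback_apply]
    have hinv := isInvertible_mfderiv_extChartAt (I := 𝓡 n) (x := c) (y := y) (by simpa using hy)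
    have h1 : mfderiv (𝓡 n) 𝓘(ℝ, Model n) (extChartAt (𝓡 n) c) y (ofModel c y v) = v := by
      rw [← TangentBundle.continuousLinearMapAt_trivializationAt hy]
      exact toModel_ofModel hy v
    symm
    rw [hinv.inverse_apply_eq]
    exact ((hW v _).trans h1.symm)
  rw [Filter.EventuallyEq.mlieBracket_vectorField_eq (key u) (key v)]
  have hc : ∀ v : Model n, MDifferentiableAt 𝓘(ℝ, Model n) 𝓘(ℝ, Model n).tangent
      (fun z => (⟨z, W v z⟩ : TangentBundle 𝓘(ℝ, Model n) (Model n))) (extChartAt (𝓡 n) c x) := by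
    intro v
    have hWv : W v = fun _ => v := funext (hW v)
    exact ((contMDiffAt_vectorSpace_iff_contDiffAt (n := 1) (V := W v)).2
      (by rw [hWv]; exact contDiffAt_const)).mdifferentiableAt (by simp)
  rw [← VectorField.mpullback_mlieBracket (n := 2) (hc u) (hc v)
    ((contMDiffAt_extChartAt' (n := ∞) hx).of_le ENat.LEInfty.out) (by simp)]
  rw [VectorField.mpullback_apply, ← VectorField.mlieBracketWithin_univ,
    VectorField.mlieBracketWithin_eq_lieBracketWithin]
  have hWu : W u = fun _ => u := funext (hW u)
  have hWv : W v = fun _ => v := funext (hW v)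
  have h0 : VectorField.lieBracketWithin ℝ (W u) (W v) univ (extChartAt (𝓡 n) c x) = 0 := by
    rw [hWu, hWv]
    simp [VectorField.lieBracketWithin]
  rw [h0]
  exact map_zero _

end Conn

section Sym
variable (E F : Type*) [NormedAddCommGroup E] [NormedSpace ℝ E] [NormedAddCommGroup F]
  [NormedSpace ℝ F]

/-- Bilinear maps `E × E → F`. -/
abbrev BilinMap : Type _ := E →L[ℝ] E →L[ℝ] F

instance : NormedAddCommGroup (BilinMap E F) := ContinuousLinearMap.toNormedAddCommGroup

instance : NormedSpace ℝ (BilinMap E F) := ContinuousLinearMap.toNormedSpace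

/-- Symmetric bilinear maps `E × E → F`. -/
def symForms : Submodule ℝ (BilinMap E F) where
  carrier := {B | ∀ u v, B u v = B v u}
  add_mem' h h' u v := by simp [h u v, h' u v]
  zero_mem' _ _ := rfl
  smul_mem' a B h u v := by simp [h u v]

/-- The normed space of symmetric bilinear maps `E × E → F`. -/
def SymForm : Type _ := symForms E F

instance : NormedAddCommGroup (SymForm E F) := Submodule.normedAddCommGroup (symForms E F)

instance : NormedSpace ℝ (SymForm E F) := Submodule.normedSpace (symForms E F)

instance [FiniteDimensional ℝ E] [FiniteDimensional ℝ F] : FiniteDimensional ℝ (SymForm E F) := by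
  have : FiniteDimensional ℝ (BilinMap E F) := inferInstance
  exact FiniteDimensional.finiteDimensional_submodule (symForms E F)

/-- The inclusion into the bilinear maps. -/
def SymForm.toBilin : SymForm E F →L[ℝ] BilinMap E F := (symForms E F).subtypeL

/-- The symmetric part of a bilinear map. -/
def symPart : BilinMap E F →L[ℝ] SymForm E F where
  toFun B := ⟨(1 / 2 : ℝ) • (B + B.flip), fun u v => by
    simp [ContinuousLinearMap.flip_apply, add_comm]⟩
  map_add' B B' := by
    refine Subtype.ext ?_
    ext u v
    change (1 / 2 : ℝ) • ((B u v + B' u v) + (B v u + B' v u)) =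
      (1 / 2 : ℝ) • (B u v + B v u) + (1 / 2 : ℝ) • (B' u v + B' v u)
    module
  map_smul' a B := by
    refine Subtype.ext ?_
    ext u v
    change (1 / 2 : ℝ) • (a • B u v + a • B v u) = a • (1 / 2 : ℝ) • (B u v + B v u)
    module
  cont := by
    have h : Continuous (fun B : E →L[ℝ] E →L[ℝ] F => B.flip) :=
      (ContinuousLinearMap.flipₗᵢ ℝ E E F).continuous
    exact ((continuous_id.add h).const_smul (1 / 2 : ℝ)).subtype_mk _

variable {E F}

lemma symPart_eq {B : E →L[ℝ] E →L[ℝ] F} {A : SymForm E F} (h : ∀ u v, B u v = A.1 u v) :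
    symPart E F B = A := by
  refine Subtype.ext ?_
  ext u v
  change (1 / 2 : ℝ) • (B u v + B v u) = A.1 u v
  rw [h, h, A.2 v u]
  module

lemma contDiff_bilinearComp [FiniteDimensional ℝ E] :
    ContDiff ℝ ∞ (fun q : (E →L[ℝ] E →L[ℝ] F) × (E →L[ℝ] E) => q.1.bilinearComp q.2 q.2) := by
  rw [contDiff_clm_apply_iff]
  intro v
  rw [contDiff_clm_apply_iff]
  intro w
  simp only [ContinuousLinearMap.bilinearComp_apply]
  fun_prop

end Sym

section Conn
variable {n : ℕ} {N : Type*} [TopologicalSpace N] [ChartedSpace (Model n) N]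
variable [IsManifold (𝓡 n) ∞ N]

lemma contDiffOn_coordChg (c c' : N) : ContDiffOn ℝ ∞ (coordChg c c')
    ((chartAt (Model n) c).symm ≫ₕ chartAt (Model n) c').source := by
  have hopen' : IsOpen ((chartAt (Model n) c').symm ≫ₕ chartAt (Model n) c).source :=
    OpenPartialHomeomorph.open_source _
  have hd := (contDiffOn_chart_change c' c).fderiv_of_isOpen (m := ∞) hopen' (by simp)
  refine hd.comp (t := ((chartAt (Model n) c').symm ≫ₕ chartAt (Model n) c).source)
    (contDiffOn_chart_change c c') ?_
  rintro q ⟨h1, h2⟩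
  refine ⟨(chartAt (Model n) c').map_source h2, ?_⟩
  change (chartAt (Model n) c').symm (chartAt (Model n) c' ((chartAt (Model n) c).symm q)) ∈
    (chartAt (Model n) c).source
  have h2 : (chartAt (Model n) c).symm q ∈ (chartAt (Model n) c').source := h2
  rw [(chartAt (Model n) c').left_inv h2]
  exact (chartAt (Model n) c).map_target h1

lemma mvfderiv_congr {x : N} {f g : N → Model n} (h : f =ᶠ[𝓝 x] g) :
    mvfderiv (𝓡 n) f x = mvfderiv (𝓡 n) g x := by
  ext1 w
  exact congrArg (fun A : Model n →L[ℝ] Model n => A w)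
    (h.mfderiv_eq (I := 𝓡 n) (I' := 𝓘(ℝ, Model n)))

namespace SymConnAt

variable {x : N}

lemma ext' {D D' : SymConnAt (n := n) x} (h : ∀ Y, D.toFun Y = D'.toFun Y) : D = D' := by
  cases D; cases D'; congr; exact funext h

lemma toFun_coordField_add (D : SymConnAt (n := n) x) {c : N}
    (hx : x ∈ (chartAt (Model n) c).source) (v w : Model n) :
    D.toFun (coordField c (v + w)) = D.toFun (coordField c v) + D.toFun (coordField c w) := by
  rw [← D.add _ _ (diffAt_coordField hx v) (diffAt_coordField hx w)]
  congr 1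
  funext y
  exact map_add _ _ _

lemma toFun_coordField_smul (D : SymConnAt (n := n) x) {c : N}
    (hx : x ∈ (chartAt (Model n) c).source) (a : ℝ) (v : Model n) :
    D.toFun (coordField c (a • v)) = a • D.toFun (coordField c v) := by
  have h := D.leibniz (fun _ => a) (coordField c v) mdifferentiableAt_const
    (diffAt_coordField hx v)
  have h2 : ((fun _ => a : N → ℝ) • coordField c v : VField n N) = coordField c (a • v) := by
    funext y
    exact (map_smul (ofModel c y) a v).symm
  rw [h2] at h
  rw [h]
  simp [mvfderiv]

/-- The Christoffel symbols, as the symmetric bilinear map `(v, u) ↦ ∇_u v` for constant fields `u`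
and `v` in the chart at `c`. -/
def christoffel (D : SymConnAt (n := n) x) (c : N) (hx : x ∈ (chartAt (Model n) c).source) :
    SymForm (Model n) (Model n) :=
  ⟨LinearMap.toContinuousLinearMap
    { toFun := fun v => (toModel c x).comp ((D.toFun (coordField c v)).comp (ofModel c x))
      map_add' := fun v w => by
        rw [D.toFun_coordField_add hx]; ext1 u; simp
      map_smul' := fun a v => by
        rw [D.toFun_coordField_smul hx]; ext1 u; simp }, by
    intro u v
    change toModel c x (D.toFun (coordField c u) (ofModel c x v)) =
      toModel c x (D.toFun (coordField c v) (ofModel c x u))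
    have h := D.torsion_free _ _ (diffAt_coordField hx u) (diffAt_coordField hx v)
    rw [mlieBracket_coordField hx, sub_eq_zero] at h
    exact congrArg (toModel c x) h.symm⟩

lemma christoffel_apply (D : SymConnAt (n := n) x) (c : N)
    (hx : x ∈ (chartAt (Model n) c).source) (v u : Model n) :
    (D.christoffel c hx).1 v u = toModel c x (D.toFun (coordField c v) (ofModel c x u)) := rfl

lemma eq_of_christoffel_eq {D D' : SymConnAt (n := n) x} (c : N)
    (hx : x ∈ (chartAt (Model n) c).source) (h : D.christoffel c hx = D'.christoffel c hx) :
    D = D' := by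
  refine ext' fun Y => ?_
  by_cases hY : Y.DiffAt x
  · have ht : TensorialAt (𝓡 n) (Model n) (fun Y : VField n N => D.toFun Y - D'.toFun Y) x := by
      constructor
      · intro f σ hf hσ
        rw [D.leibniz f σ hf hσ, D'.leibniz f σ hf hσ, smul_sub]
        abel
      · intro σ σ' hσ hσ'
        rw [D.add σ σ' hσ hσ', D'.add σ σ' hσ hσ']
        abel
    have h1 := ht.pointwise (σ := Y) (σ' := coordField c (toModel c x (Y x))) hY
      (diffAt_coordField hx _) (ofModel_toModel hx _).symm
    rw [← sub_eq_zero]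
    refine h1.trans ?_
    ext1 w
    have h2 := congrArg (fun A : SymForm (Model n) (Model n) =>
      ofModel c x (A.1 (toModel c x (Y x)) (toModel c x w))) h
    simp only [christoffel_apply, ofModel_toModel hx] at h2
    exact sub_eq_zero.2 h2
  · rw [D.junk Y hY, D'.junk Y hY]

open Classical in
/-- The connection operator with given Christoffel symbols. -/
def ofChristoffelFun (c x : N) (A : SymForm (Model n) (Model n)) (Y : VField n N) :
    TangentSpace (𝓡 n) x →L[ℝ] TangentSpace (𝓡 n) x :=
  if Y.DiffAt x then
    (ofModel c x).comp (mvfderiv (𝓡 n) (fun y => toModel c y (Y y)) x +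
      (A.1 (toModel c x (Y x))).comp (toModel c x))
  else 0

lemma ofChristoffelFun_coordField (c : N) (hx : x ∈ (chartAt (Model n) c).source)
    (A : SymForm (Model n) (Model n)) (v : Model n) (w : TangentSpace (𝓡 n) x) :
    ofChristoffelFun c x A (coordField c v) w = ofModel c x (A.1 v (toModel c x w)) := by
  rw [ofChristoffelFun, if_pos (diffAt_coordField hx v)]
  have hev : (fun y => toModel c y (coordField c v y)) =ᶠ[𝓝 x] fun _ => v := by
    filter_upwards [(chartAt (Model n) c).open_source.mem_nhds hx] with y hy
    exact toModel_ofModel hy v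
  have h1 : mvfderiv (𝓡 n) (fun y => toModel c y (coordField c v y)) x = 0 := by
    rw [mvfderiv_congr hev, mvfderiv_const]
  have h2 : toModel c x (coordField c v x) = v := toModel_ofModel hx v
  rw [h1, h2]
  simp

lemma ofChristoffelFun_add (c : N) (hx : x ∈ (chartAt (Model n) c).source)
    (A : SymForm (Model n) (Model n)) (Y Z : VField n N) (hY : Y.DiffAt x) (hZ : Z.DiffAt x) :
    ofChristoffelFun c x A (Y + Z) = ofChristoffelFun c x A Y + ofChristoffelFun c x A Z := by
  have hYZ : (Y + Z).DiffAt x := mdifferentiableAt_add_section hY hZ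
  rw [ofChristoffelFun, ofChristoffelFun, ofChristoffelFun, if_pos hY, if_pos hZ, if_pos hYZ]
  have h1 : (fun y => toModel c y ((Y + Z) y)) =
      (fun y => toModel c y (Y y)) + fun y => toModel c y (Z y) := by
    funext y
    exact map_add _ _ _
  have h2 : toModel c x ((Y + Z) x) = toModel c x (Y x) + toModel c x (Z x) := map_add _ _ _
  rw [h1, h2, mvfderiv_add ((VField.diffAt_iff hx Y).1 hY) ((VField.diffAt_iff hx Z).1 hZ)]
  ext1 w
  simp
  abel

lemma ofChristoffelFun_leibniz (c : N) (hx : x ∈ (chartAt (Model n) c).source)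
    (A : SymForm (Model n) (Model n)) (f : N → ℝ) (Y : VField n N)
    (hf : MDifferentiableAt (𝓡 n) 𝓘(ℝ, ℝ) f x) (hY : Y.DiffAt x) :
    ofChristoffelFun c x A (f • Y) = f x • ofChristoffelFun c x A Y +
      (mvfderiv (𝓡 n) f x).smulRight (Y x) := by
  have hfY : (f • Y).DiffAt x := MDifferentiableAt.smul_section hf hY
  rw [ofChristoffelFun, ofChristoffelFun, if_pos hY, if_pos hfY]
  have h1 : (fun y => toModel c y ((f • Y) y)) = f • fun y => toModel c y (Y y) := by
    funext y
    exact map_smul (toModel c y) (f y) (Y y)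
  have h2 : toModel c x ((f • Y) x) = f x • toModel c x (Y x) :=
    map_smul (toModel c x) (f x) (Y x)
  rw [h1, h2, mvfderiv_smul hf ((VField.diffAt_iff hx Y).1 hY)]
  ext1 w
  simp [ofModel_toModel hx]
  abel

lemma ofChristoffelFun_torsion (c : N) (hx : x ∈ (chartAt (Model n) c).source)
    (A : SymForm (Model n) (Model n)) (Y Z : VField n N) (hY : Y.DiffAt x) (hZ : Z.DiffAt x) :
    ofChristoffelFun c x A Z (Y x) - ofChristoffelFun c x A Y (Z x) =
      VectorField.mlieBracket (𝓡 n) Y Z x := by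
  have : IsManifold (𝓡 n) (minSmoothness ℝ 2) N := IsManifold.of_le (n := ∞) (by
    rw [minSmoothness_of_isRCLikeNormedField]; exact ENat.LEInfty.out)
  let Φ : VField n N → VField n N → TangentSpace (𝓡 n) x := fun Y Z =>
    ofChristoffelFun c x A Z (Y x) - ofChristoffelFun c x A Y (Z x) -
      VectorField.mlieBracket (𝓡 n) Y Z x
  have h1 : ∀ Z : VField n N, Z.DiffAt x → TensorialAt (𝓡 n) (Model n) (Φ · Z) x := by
    intro Z hZ
    constructor
    · intro f σ hf hσ
      simp only [Φ]
      rw [ofChristoffelFun_leibniz c hx A f σ hf hσ, VectorField.mlieBracket_smul_left hf hσ]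
      simp
      module
    · intro σ σ' hσ hσ'
      simp only [Φ]
      rw [ofChristoffelFun_add c hx A σ σ' hσ hσ', VectorField.mlieBracket_add_left hσ hσ']
      simp
      module
  have h2 : ∀ Y : VField n N, Y.DiffAt x → TensorialAt (𝓡 n) (Model n) (Φ Y) x := by
    intro Y hY
    constructor
    · intro f σ hf hσ
      simp only [Φ]
      rw [ofChristoffelFun_leibniz c hx A f σ hf hσ, VectorField.mlieBracket_smul_right hf hσ]
      simp
      module
    · intro σ σ' hσ hσ'
      simp only [Φ]
      rw [ofChristoffelFun_add c hx A σ σ' hσ hσ', VectorField.mlieBracket_add_right hσ hσ']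
      simp
      module
  have h3 := TensorialAt.pointwise₂ (Φ := Φ) h1 h2 hY
    (diffAt_coordField hx (toModel c x (Y x))) hZ (diffAt_coordField hx (toModel c x (Z x)))
    (ofModel_toModel hx _).symm (ofModel_toModel hx _).symm
  rw [← sub_eq_zero]
  refine h3.trans ?_
  simp only [Φ]
  rw [mlieBracket_coordField hx, ofChristoffelFun_coordField c hx,
    ofChristoffelFun_coordField c hx]
  have h4 : ∀ v : Model n, toModel c x (coordField c v x) = v := toModel_ofModel hx
  rw [h4, h4, A.2, sub_self, sub_zero]

/-- The connection at `x` with given Christoffel symbols in the chart at `c`. -/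
def ofChristoffel (c : N) (hx : x ∈ (chartAt (Model n) c).source)
    (A : SymForm (Model n) (Model n)) : SymConnAt (n := n) x where
  toFun := ofChristoffelFun c x A
  add := ofChristoffelFun_add c hx A
  leibniz := ofChristoffelFun_leibniz c hx A
  torsion_free := ofChristoffelFun_torsion c hx A
  junk _ hY := if_neg hY

lemma christoffel_ofChristoffel (c : N) (hx : x ∈ (chartAt (Model n) c).source)
    (A : SymForm (Model n) (Model n)) : (ofChristoffel c hx A).christoffel c hx = A := by
  refine Subtype.ext ?_
  ext1 v; ext1 u
  rw [christoffel_apply]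
  change toModel c x (ofChristoffelFun c x A (coordField c v) (ofModel c x u)) = _
  rw [ofChristoffelFun_coordField c hx, toModel_ofModel hx, toModel_ofModel hx]

lemma ofChristoffel_christoffel (D : SymConnAt (n := n) x) (c : N)
    (hx : x ∈ (chartAt (Model n) c).source) : ofChristoffel c hx (D.christoffel c hx) = D :=
  eq_of_christoffel_eq c hx (christoffel_ofChristoffel c hx _)

lemma christoffel_trans (D : SymConnAt (n := n) x) {c c' : N}
    (hx : x ∈ (chartAt (Model n) c).source) (hx' : x ∈ (chartAt (Model n) c').source)
    (v u : Model n) :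
    (D.christoffel c' hx').1 v u = coordChg c' c (chartAt (Model n) c' x)
      (fderiv ℝ (coordChg c c') (chartAt (Model n) c x)
          (coordChg c c' (chartAt (Model n) c x) u) v +
        (D.christoffel c hx).1 (coordChg c c' (chartAt (Model n) c x) v)
          (coordChg c c' (chartAt (Model n) c x) u)) := by
  have hl := (chartAt (Model n) c).left_inv hx
  rw [christoffel_apply]
  have h0 : D.toFun (coordField c' v) = ofChristoffelFun c x (D.christoffel c hx)
      (coordField c' v) := by
    conv_lhs => rw [← ofChristoffel_christoffel D c hx]
    rfl
  rw [h0, ofChristoffelFun, if_pos (diffAt_coordField hx' v)]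
  have hT : ∀ w : Model n, toModel c x (ofModel c' x w) =
    coordChg c c' (chartAt (Model n) c x) w := toModel_ofModel_eq hx hx'
  have hdiff : DifferentiableAt ℝ (coordChg c c') (chartAt (Model n) c x) :=
    ((contDiffOn_coordChg c c').contDiffAt ((OpenPartialHomeomorph.open_source _).mem_nhds
      ⟨(chartAt (Model n) c).map_source hx, by simpa [hl] using hx'⟩)).differentiableAt (by simp)
  have hev : (fun y => toModel c y (coordField c' v y)) =ᶠ[𝓝 x]
      (fun u => coordChg c c' u v) ∘ (chartAt (Model n) c) := by
    filter_upwards [(chartAt (Model n) c).open_source.mem_nhds hx,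
      (chartAt (Model n) c').open_source.mem_nhds hx'] with y hy hy'
    exact toModel_ofModel_eq hy hy' v
  have hφ : MDifferentiableAt (𝓡 n) 𝓘(ℝ, Model n) (chartAt (Model n) c) x :=
    mdifferentiableAt_atlas (I := 𝓡 n) (chart_mem_atlas _ c) hx
  have hφ' : ∀ w : TangentSpace (𝓡 n) x,
      mfderiv (𝓡 n) 𝓘(ℝ, Model n) (chartAt (Model n) c) x w = toModel c x w := by
    intro w
    have := TangentBundle.continuousLinearMapAt_trivializationAt (I := 𝓡 n) hx
    exact (congrArg (fun A : Model n →L[ℝ] Model n => A w) this).symm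
  have hg : HasFDerivAt (fun u => coordChg c c' u v)
      ((fderiv ℝ (coordChg c c') (chartAt (Model n) c x)).flip v) (chartAt (Model n) c x) :=
    by simpa using hdiff.hasFDerivAt.clm_apply (hasFDerivAt_const v _)
  have hd : ∀ w : TangentSpace (𝓡 n) x,
      mvfderiv (𝓡 n) (fun y => toModel c y (coordField c' v y)) x w =
      fderiv ℝ (coordChg c c') (chartAt (Model n) c x) (toModel c x w) v := by
    intro w
    have h7 : mvfderiv (𝓡 n) ((fun u => coordChg c c' u v) ∘ (chartAt (Model n) c)) x w =
        mvfderiv 𝓘(ℝ, Model n) (fun u => coordChg c c' u v) (chartAt (Model n) c x)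
          (mfderiv (𝓡 n) 𝓘(ℝ, Model n) (chartAt (Model n) c) x w) :=
      mfderiv_comp_apply (I' := 𝓘(ℝ, Model n)) (I'' := 𝓘(ℝ, Model n)) x
        hg.differentiableAt.mdifferentiableAt hφ w
    rw [mvfderiv_congr hev, h7, hφ' w]
    have h5 : mvfderiv 𝓘(ℝ, Model n) (fun u => coordChg c c' u v) (chartAt (Model n) c x) =
        (fderiv ℝ (coordChg c c') (chartAt (Model n) c x)).flip v := by
      rw [← hg.fderiv]
      ext1 w
      exact congrArg (fun A : Model n →L[ℝ] Model n => A w) mfderiv_eq_fderiv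
    rw [h5]
    rfl
  simp only [ContinuousLinearMap.comp_apply, add_apply, hd, hT]
  rw [toModel_ofModel_eq hx' hx]
  have h6 : toModel c x (coordField c' v x) = coordChg c c' (chartAt (Model n) c x) v := hT v
  rw [h6]

end SymConnAt
end Conn

section Metric

/-- The quadratic form `u ↦ B u u`. -/
def quadForm {W : Type*} [AddCommGroup W] [Module ℝ W] [TopologicalSpace W]
    (B : W →L[ℝ] W →L[ℝ] ℝ) : QuadraticForm ℝ W :=
  LinearMap.BilinMap.toQuadraticMap B.toBilinForm

/-- `B` is a nondegenerate symmetric bilinear form of signature `(p, q)`: `p` positive and `q`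
negative directions. -/
structure IsPseudoMetric {W : Type*} [AddCommGroup W] [Module ℝ W] [TopologicalSpace W]
    (p q : ℕ) (B : W →L[ℝ] W →L[ℝ] ℝ) : Prop where
  symm : ∀ u v, B u v = B v u
  nondegenerate : ∀ u, (∀ v, B u v = 0) → u = 0
  sigPos_eq : sigPos (quadForm B) = p
  sigNeg_eq : sigNeg (quadForm B) = q

lemma IsPseudoMetric.of_equiv {W W' : Type*} [AddCommGroup W] [Module ℝ W] [TopologicalSpace W]
    [AddCommGroup W'] [Module ℝ W'] [TopologicalSpace W'] {p q : ℕ}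
    {B : W →L[ℝ] W →L[ℝ] ℝ} {B' : W' →L[ℝ] W' →L[ℝ] ℝ} (h : IsPseudoMetric p q B)
    (e : W ≃ₗ[ℝ] W') (he : ∀ u v, B' (e u) (e v) = B u v) : IsPseudoMetric p q B' := by
  have heq : (quadForm B).Equivalent (quadForm B') := ⟨⟨e, fun u => he u u⟩⟩
  refine ⟨fun u v => ?_, fun u hu => ?_, ?_, ?_⟩
  · obtain ⟨u, rfl⟩ := e.surjective u
    obtain ⟨v, rfl⟩ := e.surjective v
    rw [he, he, h.symm]
  · obtain ⟨u, rfl⟩ := e.surjective u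
    rw [h.nondegenerate u (fun v => by rw [← he, hu]), map_zero]
  · rw [← heq.sigPos_eq, h.sigPos_eq]
  · rw [← heq.sigNeg_eq, h.sigNeg_eq]

variable {E : Type*} [NormedAddCommGroup E] [NormedSpace ℝ E]

/-- The pull-back of a symmetric form. -/
def pullSym (B : SymForm E ℝ) (A : E →L[ℝ] E) : SymForm E ℝ :=
  symPart E ℝ (B.1.bilinearComp A A)

lemma pullSym_apply (B : SymForm E ℝ) (A : E →L[ℝ] E) (u v : E) :
    (pullSym B A).1 u v = B.1 (A u) (A v) := by
  change (1 / 2 : ℝ) • (B.1 (A u) (A v) + B.1 (A v) (A u)) = _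
  rw [B.2 (A v)]
  module

lemma contDiff_pullSym [FiniteDimensional ℝ E] :
    ContDiff ℝ ∞ fun r : SymForm E ℝ × (E →L[ℝ] E) => pullSym r.1 r.2 := by
  have h1 : ContDiff ℝ ∞ (fun r : SymForm E ℝ × (E →L[ℝ] E) => (r.1.1, r.2)) :=
    ((SymForm.toBilin E ℝ).contDiff.comp contDiff_fst).prodMk contDiff_snd
  have h2 := contDiff_bilinearComp.comp h1
  exact (symPart E ℝ).contDiff.comp h2

lemma fderiv_eq_of_line {V W : Type*} [NormedAddCommGroup V] [NormedSpace ℝ V]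
    [NormedAddCommGroup W] [NormedSpace ℝ W] {f : V → W} {x v : V} {b c d : W}
    (hf : DifferentiableAt ℝ f x) (h : ∀ t : ℝ, f (x + t • v) = b + t • c + (t * t) • d) :
    fderiv ℝ f x v = c := by
  rw [← hf.lineDeriv_eq_fderiv, lineDeriv]
  have h5 : HasDerivAt (fun t : ℝ => b + t • c + (t * t) • d) c 0 := by
    have h6 := (((hasDerivAt_id (0 : ℝ)).smul_const c).const_add b).add
      (((hasDerivAt_id (0 : ℝ)).mul (hasDerivAt_id (0 : ℝ))).smul_const d)
    simpa using! h6
  rw [funext h, h5.deriv]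

lemma fderiv_pullSym [FiniteDimensional ℝ E] (B C : SymForm E ℝ) (A : E →L[ℝ] E)
    (h : ∀ u v, B.1 (A u) v + B.1 u (A v) = C.1 u v) : fderiv ℝ (pullSym B) 1 A = C := by
  have hf : DifferentiableAt ℝ (pullSym B) 1 :=
    (contDiff_pullSym.comp (contDiff_const.prodMk contDiff_id)).contDiffAt.differentiableAt
      (n := ∞) (by simp)
  refine fderiv_eq_of_line (b := B) (d := pullSym B A) hf fun t => ?_
  refine Subtype.ext ?_
  ext u v
  rw [pullSym_apply]
  change B.1 (u + t • A u) (v + t • A v) =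
    B.1 u v + t • C.1 u v + (t * t) • (pullSym B A).1 u v
  rw [← h, pullSym_apply]
  simp
  ring

/-- The nondegenerate symmetric bilinear forms of signature `(p, q)` on `E`. -/
def pseudoForms (E : Type*) [NormedAddCommGroup E] [NormedSpace ℝ E] (p q : ℕ) :
    Set (SymForm E ℝ) := {B | IsPseudoMetric p q B.1}

lemma isOpen_pseudoForms (E : Type*) [NormedAddCommGroup E] [NormedSpace ℝ E]
    [FiniteDimensional ℝ E] (p q : ℕ) : IsOpen (pseudoForms E p q) := by
  have : CompleteSpace E := FiniteDimensional.complete ℝ E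
  have : CompleteSpace (SymForm E ℝ) := FiniteDimensional.complete ℝ _
  rw [isOpen_iff_mem_nhds]
  intro B hB
  have hs : HasStrictFDerivAt (pullSym B) (fderiv ℝ (pullSym B) 1) 1 :=
    (contDiff_pullSym.comp (contDiff_const.prodMk contDiff_id)).contDiffAt.hasStrictFDerivAt
      (n := ∞) (by simp)
  have hf1 : pullSym B 1 = B := symPart_eq fun u v => rfl
  have hinj : Function.Injective (B.1 : E →ₗ[ℝ] (E →L[ℝ] ℝ)) := by
    rw [injective_iff_map_eq_zero]
    intro u hu
    exact hB.nondegenerate u fun v => congrArg (fun L : E →L[ℝ] ℝ => L v) hu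
  have hrank : Module.finrank ℝ E = Module.finrank ℝ (E →L[ℝ] ℝ) := by
    rw [← (LinearMap.toContinuousLinearMap (𝕜 := ℝ) (E := E) (F' := ℝ)).finrank_eq]
    exact (Subspace.dual_finrank_eq).symm
  let e := LinearEquiv.ofInjectiveOfFinrankEq _ hinj hrank
  have he : ∀ u v, e u v = B.1 u v := fun u v => rfl
  have hsurj : (fderiv ℝ (pullSym B) 1).range = ⊤ := by
    rw [LinearMap.range_eq_top]
    intro C
    refine ⟨LinearMap.toContinuousLinearMap (e.symm.toLinearMap ∘ₗ
      ((1 / 2 : ℝ) • (C.1 : E →ₗ[ℝ] (E →L[ℝ] ℝ)))), ?_⟩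
    refine fderiv_pullSym B C _ fun u v => ?_
    have h7 : ∀ u v, B.1 (e.symm ((1 / 2 : ℝ) • C.1 u)) v = (1 / 2 : ℝ) • C.1 u v := by
      intro u v
      rw [← he, LinearEquiv.apply_symm_apply]
      rfl
    change B.1 (e.symm ((1 / 2 : ℝ) • C.1 u)) v + B.1 u (e.symm ((1 / 2 : ℝ) • C.1 v)) = _
    rw [B.2 u, h7, h7, C.2 v u]
    module
  have hm := hs.map_nhds_eq_of_surj hsurj
  rw [hf1] at hm
  rw [← hm]
  have hU : {A : E →L[ℝ] E | IsUnit A} ∈ 𝓝 (1 : E →L[ℝ] E) :=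
    Units.isOpen.mem_nhds isUnit_one
  refine mem_of_superset (image_mem_map hU) ?_
  rintro _ ⟨A, ⟨a, rfl⟩, rfl⟩
  let eq := (ContinuousLinearEquiv.unitsEquiv ℝ E a).toLinearEquiv
  refine IsPseudoMetric.of_equiv hB eq.symm fun u v => ?_
  rw [pullSym_apply]
  change B.1 (eq (eq.symm u)) (eq (eq.symm v)) = _
  rw [LinearEquiv.apply_symm_apply, LinearEquiv.apply_symm_apply]

end Metric

lemma contDiffOn_comp_aux {U V W X : Type*} [NormedAddCommGroup U] [NormedSpace ℝ U]
    [NormedAddCommGroup V] [NormedSpace ℝ V] [NormedAddCommGroup W] [NormedSpace ℝ W]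
    [NormedAddCommGroup X] [NormedSpace ℝ X] {g : V → W → X}
    (hg : ContDiff ℝ ∞ fun r : V × W => g r.1 r.2) {h : U → W} {s : Set U}
    (hh : ContDiffOn ℝ ∞ h s) (t : Set V) :
    ContDiffOn ℝ ∞ (fun r : U × V => g r.2 (h r.1)) (s ×ˢ t) :=
  hg.comp_contDiffOn (contDiffOn_snd.prodMk (hh.comp contDiffOn_fst fun _ hr => hr.1))

section MetricBundle

variable (n : ℕ) (N : Type*) [TopologicalSpace N] [ChartedSpace (Model n) N]
  [IsManifold (𝓡 n) ∞ N] (p q : ℕ)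

/-- A point of the bundle of pseudo-Riemannian metrics of signature `(p, q)`: a point of `N` and a
form of signature `(p, q)` on its tangent space. -/
structure MetricPoint where
  base : N
  form : TangentSpace (𝓡 n) base →L[ℝ] TangentSpace (𝓡 n) base →L[ℝ] ℝ
  isMetric : IsPseudoMetric p q form

variable {n N p q}

/-- Components of a bilinear form on a tangent space. -/
def pullForm {x : N} (L : Model n →L[ℝ] TangentSpace (𝓡 n) x)
    (B : TangentSpace (𝓡 n) x →L[ℝ] TangentSpace (𝓡 n) x →L[ℝ] ℝ) :
    Model n →L[ℝ] Model n →L[ℝ] ℝ :=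
  (ContinuousLinearMap.precomp ℝ L).comp (B.comp L)

/-- The bilinear form on a tangent space with given components. -/
def pushForm {x : N} (L : TangentSpace (𝓡 n) x →L[ℝ] Model n)
    (B : Model n →L[ℝ] Model n →L[ℝ] ℝ) :
    TangentSpace (𝓡 n) x →L[ℝ] TangentSpace (𝓡 n) x →L[ℝ] ℝ :=
  (ContinuousLinearMap.precomp ℝ L).comp (B.comp L)

/-- The components `y_ij` of a metric in the chart at `c`. -/
def MetricPoint.coord (c : N) (m : MetricPoint n N p q) : SymForm (Model n) ℝ :=
  symPart (Model n) ℝ (pullForm (ofModel c m.base) m.form)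

lemma MetricPoint.coord_apply (c : N) (m : MetricPoint n N p q) (u v : Model n) :
    (m.coord c).1 u v = m.form (ofModel c m.base u) (ofModel c m.base v) := by
  change (1 / 2 : ℝ) • (m.form (ofModel c m.base u) (ofModel c m.base v) +
    m.form (ofModel c m.base v) (ofModel c m.base u)) = _
  rw [m.isMetric.symm (ofModel c m.base v)]
  module

/-- The components of tangent vectors, as a linear isomorphism. -/
def modelEquiv (c x : N) (hx : x ∈ (chartAt (Model n) c).source) :
    Model n ≃ₗ[ℝ] TangentSpace (𝓡 n) x where
  toLinearMap := (ofModel (n := n) c x).toLinearMap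
  invFun := toModel c x
  left_inv := toModel_ofModel hx
  right_inv := ofModel_toModel hx

lemma MetricPoint.bijOn_coord (c y : N) (hy : y ∈ (chartAt (Model n) c).source) :
    BijOn (MetricPoint.coord (p := p) (q := q) c) (MetricPoint.base ⁻¹' {y})
      (pseudoForms (Model n) p q) := by
  refine ⟨?_, ?_, ?_⟩
  · rintro ⟨x, B, hB⟩ hx
    obtain rfl : x = y := hx
    refine hB.of_equiv (modelEquiv c x hy).symm fun u v => ?_
    rw [MetricPoint.coord_apply]
    change B (ofModel c x (toModel c x u)) (ofModel c x (toModel c x v)) = _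
    rw [ofModel_toModel hy, ofModel_toModel hy]
  · rintro ⟨x, B, hB⟩ hx ⟨x', B', hB'⟩ hx' h
    obtain rfl : x = y := hx
    obtain rfl : x' = x := hx'
    have : B = B' := by
      ext u v
      have h1 := congrArg (fun A : SymForm (Model n) ℝ =>
        A.1 (toModel c x' u) (toModel c x' v)) h
      simp only [MetricPoint.coord_apply] at h1
      change B (ofModel c x' (toModel c x' u)) (ofModel c x' (toModel c x' v)) =
        B' (ofModel c x' (toModel c x' u)) (ofModel c x' (toModel c x' v)) at h1
      rwa [ofModel_toModel hy, ofModel_toModel hy] at h1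
    subst this
    rfl
  · intro A hA
    have h1 : IsPseudoMetric p q (pushForm (toModel c y) A.1) := by
      refine IsPseudoMetric.of_equiv hA (modelEquiv c y hy) fun u v => ?_
      change A.1 (toModel c y (ofModel c y u)) (toModel c y (ofModel c y v)) = _
      rw [toModel_ofModel hy, toModel_ofModel hy]
    refine ⟨⟨y, _, h1⟩, rfl, ?_⟩
    refine Subtype.ext ?_
    ext u v
    rw [MetricPoint.coord_apply]
    change A.1 (toModel c y (ofModel c y u)) (toModel c y (ofModel c y v)) = _
    rw [toModel_ofModel hy, toModel_ofModel hy]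

/-- The change of the components of a metric. -/
def metricTrans (c c' : N) (r : Model n × SymForm (Model n) ℝ) : SymForm (Model n) ℝ :=
  pullSym r.2 (coordChg c c' r.1)

lemma MetricPoint.coord_eq_trans (c c' : N) (m : MetricPoint n N p q)
    (h : m.base ∈ (chartAt (Model n) c).source) (h' : m.base ∈ (chartAt (Model n) c').source) :
    m.coord c' = metricTrans c c' (chartAt (Model n) c m.base, m.coord c) := by
  refine (symPart_eq fun u v => ?_).symm
  change (m.coord c).1 (coordChg c c' (chartAt (Model n) c m.base) u)
    (coordChg c c' (chartAt (Model n) c m.base) v) = _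
  rw [← toModel_ofModel_eq h h', ← toModel_ofModel_eq h h', coord_apply, coord_apply,
    ofModel_toModel h, ofModel_toModel h]

lemma contDiffOn_metricTrans (c c' : N) : ContDiffOn ℝ ∞ (metricTrans c c')
    (((chartAt (Model n) c).symm ≫ₕ chartAt (Model n) c').source ×ˢ pseudoForms (Model n) p q) := by
  exact contDiffOn_comp_aux contDiff_pullSym (contDiffOn_coordChg c c') _

variable (n N p q) in
/-- The bundle of pseudo-Riemannian metrics of signature `(p, q)` on `N`, with the coordinates `y_ij`. -/
def metricCoords : FibreCoords n N (SymForm (Model n) ℝ) (MetricPoint n N p q) where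
  proj := MetricPoint.base
  fib := pseudoForms (Model n) p q
  isOpen_fib := isOpen_pseudoForms _ p q
  coord := MetricPoint.coord
  bijOn := MetricPoint.bijOn_coord
  trans := metricTrans
  coord_eq_trans := MetricPoint.coord_eq_trans
  contDiffOn_trans := contDiffOn_metricTrans

end MetricBundle

section MetricConnBundle

variable (n : ℕ) (N : Type*) [TopologicalSpace N] [ChartedSpace (Model n) N]
  [IsManifold (𝓡 n) ∞ N] (p q : ℕ)

/-- A point of the fibre product of the bundle of metrics of signature `(p, q)` and the bundle of
symmetric linear connections. -/
structure MetricConnPoint where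
  metric : MetricPoint n N p q
  conn : SymConnAt (n := n) metric.base

variable {n N p q}

open Classical in
/-- The components of the metric and the Christoffel symbols of the connection. -/
def MetricConnPoint.coord (c : N) (e : MetricConnPoint n N p q) :
    SymForm (Model n) ℝ × SymForm (Model n) (Model n) :=
  (e.metric.coord c, if h : e.metric.base ∈ (chartAt (Model n) c).source then
    e.conn.christoffel c h else 0)

lemma MetricConnPoint.coord_of_mem {c : N} {m : MetricPoint n N p q}
    (D : SymConnAt (n := n) m.base) (h : m.base ∈ (chartAt (Model n) c).source) :
    MetricConnPoint.coord c ⟨m, D⟩ = (m.coord c, D.christoffel c h) :=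
  Prod.ext rfl (dif_pos h)

lemma MetricConnPoint.bijOn_coord (c y : N) (hy : y ∈ (chartAt (Model n) c).source) :
    BijOn (MetricConnPoint.coord (p := p) (q := q) c)
      ((fun e : MetricConnPoint n N p q => e.metric.base) ⁻¹' {y})
      (pseudoForms (Model n) p q ×ˢ univ) := by
  refine ⟨?_, ?_, ?_⟩
  · rintro ⟨m, D⟩ hm
    exact ⟨(MetricPoint.bijOn_coord c y hy).mapsTo hm, mem_univ _⟩
  · rintro ⟨m, D⟩ hm ⟨m', D'⟩ hm' h
    obtain rfl : m = m' :=
      (MetricPoint.bijOn_coord c y hy).injOn hm hm' (congrArg Prod.fst h)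
    obtain rfl : m.base = y := hm
    rw [coord_of_mem D hy, coord_of_mem D' hy] at h
    rw [SymConnAt.eq_of_christoffel_eq c hy (congrArg Prod.snd h)]
  · rintro ⟨B, A⟩ ⟨hB, -⟩
    obtain ⟨m, hm, hmB⟩ := (MetricPoint.bijOn_coord c y hy).surjOn hB
    obtain rfl : m.base = y := hm
    refine ⟨⟨m, SymConnAt.ofChristoffel c hy A⟩, rfl, ?_⟩
    rw [coord_of_mem _ hy, hmB, SymConnAt.christoffel_ofChristoffel]

/-- The classical change of Christoffel symbols. -/
def connPull {E : Type*} [NormedAddCommGroup E] [NormedSpace ℝ E] (A : SymForm E E)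
    (r : (E →L[ℝ] E) × (E →L[ℝ] E) × (E →L[ℝ] E →L[ℝ] E)) : SymForm E E :=
  symPart E E ((ContinuousLinearMap.compL ℝ E E E r.2.1).comp
    ((r.2.2.comp r.1).flip + A.1.bilinearComp r.1 r.1))

lemma contDiff_connPull {E : Type*} [NormedAddCommGroup E] [NormedSpace ℝ E]
    [FiniteDimensional ℝ E] : ContDiff ℝ ∞
      fun s : SymForm E E × (E →L[ℝ] E) × (E →L[ℝ] E) × (E →L[ℝ] E →L[ℝ] E) =>
        connPull s.1 s.2 := by
  refine (symPart E E).contDiff.comp ?_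
  rw [contDiff_clm_apply_iff]
  intro v
  rw [contDiff_clm_apply_iff]
  intro w
  have h : ContDiff ℝ ∞
      fun s : SymForm E E × (E →L[ℝ] E) × (E →L[ℝ] E) × (E →L[ℝ] E →L[ℝ] E) =>
        SymForm.toBilin E E s.1 := by fun_prop
  change ContDiff ℝ ∞
      fun s : SymForm E E × (E →L[ℝ] E) × (E →L[ℝ] E) × (E →L[ℝ] E →L[ℝ] E) =>
        s.2.2.1 (s.2.2.2 (s.2.1 w) v + SymForm.toBilin E E s.1 (s.2.1 v) (s.2.1 w))
  fun_prop

lemma contDiffOn_connPull {U E : Type*} [NormedAddCommGroup E] [NormedSpace ℝ E]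
    [NormedAddCommGroup U] [NormedSpace ℝ U] [FiniteDimensional ℝ E]
    {T S : U → (E →L[ℝ] E)} {D : U → (E →L[ℝ] E →L[ℝ] E)} {s : Set U}
    (hT : ContDiffOn ℝ ∞ T s) (hS : ContDiffOn ℝ ∞ S s) (hD : ContDiffOn ℝ ∞ D s)
    (t : Set (SymForm E E)) :
    ContDiffOn ℝ ∞ (fun r : U × SymForm E E => connPull r.2 (T r.1, S r.1, D r.1)) (s ×ˢ t) := 
  contDiffOn_comp_aux contDiff_connPull (hT.prodMk (hS.prodMk hD)) _

/-- The change of the Christoffel symbols from the chart at `c` to the chart at `c'`. -/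
def connTrans (c c' : N) (r : Model n × SymForm (Model n) (Model n)) :
    SymForm (Model n) (Model n) :=
  connPull r.2 (coordChg c c' r.1,
    coordChg c' c (chartAt (Model n) c' ((chartAt (Model n) c).symm r.1)),
    fderiv ℝ (coordChg c c') r.1)

lemma SymConnAt.christoffel_eq_trans (c c' : N) {x : N} (D : SymConnAt (n := n) x)
    (hx : x ∈ (chartAt (Model n) c).source) (hx' : x ∈ (chartAt (Model n) c').source) :
    D.christoffel c' hx' = connTrans c c' (chartAt (Model n) c x, D.christoffel c hx) := by
  refine (symPart_eq fun v u => ?_).symm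
  rw [D.christoffel_trans hx hx']
  simp only [(chartAt (Model n) c).left_inv hx]
  rfl

lemma contDiffOn_connTrans (c c' : N) : ContDiffOn ℝ ∞ (connTrans c c')
    (((chartAt (Model n) c).symm ≫ₕ chartAt (Model n) c').source ×ˢ univ) := by
  have hopen : IsOpen ((chartAt (Model n) c).symm ≫ₕ chartAt (Model n) c').source :=
    OpenPartialHomeomorph.open_source _
  have hT := contDiffOn_coordChg (n := n) c c'
  have hD : ContDiffOn ℝ ∞ (fderiv ℝ (coordChg (n := n) c c'))
      ((chartAt (Model n) c).symm ≫ₕ chartAt (Model n) c').source :=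
    hT.fderiv_of_isOpen (m := ∞) hopen (by simp)
  have hS : ContDiffOn ℝ ∞ (fun u =>
      coordChg (n := n) c' c (chartAt (Model n) c' ((chartAt (Model n) c).symm u)))
      ((chartAt (Model n) c).symm ≫ₕ chartAt (Model n) c').source := by
    refine (contDiffOn_coordChg (n := n) c' c).comp (t := ((chartAt (Model n) c').symm ≫ₕ
      chartAt (Model n) c).source) (contDiffOn_chart_change (n := n) c c') ?_
    rintro u ⟨h1, h2⟩
    refine ⟨(chartAt (Model n) c').map_source h2, ?_⟩
    change (chartAt (Model n) c').symm (chartAt (Model n) c' ((chartAt (Model n) c).symm u)) ∈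
      (chartAt (Model n) c).source
    have h2 : (chartAt (Model n) c).symm u ∈ (chartAt (Model n) c').source := h2
    rw [(chartAt (Model n) c').left_inv h2]
    exact (chartAt (Model n) c).map_target h1
  exact contDiffOn_connPull (E := Model n) hT hS hD univ

variable (n N p q) in
/-- The fibre product over `N` of the bundle of metrics of signature `(p, q)` and the bundle of
symmetric linear connections, with the components `y_ij` and the Christoffel symbols as coordinates. -/
def metricConnCoords : FibreCoords n N (SymForm (Model n) ℝ × SymForm (Model n) (Model n))
    (MetricConnPoint n N p q) where
  proj e := e.metric.base
  fib := pseudoForms (Model n) p q ×ˢ univ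
  isOpen_fib := (isOpen_pseudoForms _ p q).prod isOpen_univ
  coord := MetricConnPoint.coord
  bijOn := MetricConnPoint.bijOn_coord
  trans c c' r := (metricTrans c c' (r.1, r.2.1), connTrans c c' (r.1, r.2.2))
  coord_eq_trans c c' e h h' := by
    obtain ⟨m, D⟩ := e
    rw [MetricConnPoint.coord_of_mem D h', MetricConnPoint.coord_of_mem D h,
      MetricPoint.coord_eq_trans c c' m h h', D.christoffel_eq_trans c c' h h']
  contDiffOn_trans c c' :=
    ((contDiffOn_metricTrans c c').comp (f := fun r : Model n × (SymForm (Model n) ℝ ×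
        SymForm (Model n) (Model n)) => (r.1, r.2.1)) (by fun_prop)
        fun r hr => ⟨hr.1, hr.2.1⟩).prodMk
      ((contDiffOn_connTrans c c').comp (f := fun r : Model n × (SymForm (Model n) ℝ ×
        SymForm (Model n) (Model n)) => (r.1, r.2.2)) (by fun_prop)
        fun r hr => ⟨hr.1, mem_univ _⟩)

end MetricConnBundle

section Ehresmann

variable {E H E' H' N X : Type*} [NormedAddCommGroup E] [NormedSpace ℝ E] [TopologicalSpace H]
  [NormedAddCommGroup E'] [NormedSpace ℝ E'] [TopologicalSpace H']
  (I : ModelWithCorners ℝ E H) (J : ModelWithCorners ℝ E' H')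
  [TopologicalSpace N] [ChartedSpace H N] [TopologicalSpace X] [ChartedSpace H' X]

/-- The vertical space of `p` at `e`: the kernel of the differential of `p`. -/
def VerticalSpace (p : X → N) (e : X) : Submodule ℝ (TangentSpace J e) :=
  LinearMap.ker (mfderiv J I p e).toLinearMap

/-- A (first-order) Ehresmann connection on `p : X → N`: a smooth 1-form on `X` with values in the
vertical bundle of `p` that is the identity on vertical vectors. Smoothness is that of a section
of the bundle `Hom(TX, TX)`. -/
structure EhresmannConnection [IsManifold J ∞ X] (p : X → N) where
  form : ∀ e : X, TangentSpace J e →L[ℝ] VerticalSpace I J p e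
  contMDiff_form : ContMDiff J (J.prod 𝓘(ℝ, E' →L[ℝ] E')) ∞ (fun e : X =>
    TotalSpace.mk' (E' →L[ℝ] E') (E := fun e : X => TangentSpace J e →L[ℝ] TangentSpace J e) e
      ((VerticalSpace I J p e).subtypeL.comp (form e)))
  form_vertical : ∀ (e : X) (v : VerticalSpace I J p e), form e v = v

end Ehresmann

section Bundles

variable (n : ℕ) (N : Type*) [TopologicalSpace N] [ChartedSpace (Model n) N]
  [IsManifold (𝓡 n) ∞ N] (p q : ℕ)

/-- The total space of the bundle of metrics. -/
abbrev MetricBundle : Type _ := (metricCoords n N p q).Total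

/-- The total space of the bundle of 1-jets of metrics. An Ehresmann connection on its projection to
`N` is a second-order Ehresmann connection on the bundle of metrics. -/
abbrev MetricJetBundle : Type _ := (metricCoords n N p q).jetCoords.Total

/-- The total space of the fibre product of the bundles of metrics and of symmetric connections. -/
abbrev MetricConnBundle : Type _ := (metricConnCoords n N p q).Total

/-- The model vector space of the bundle of metrics. -/
abbrev MetricModel : Type := Model n × SymForm (Model n) ℝ

/-- The model vector space of the bundle of 1-jets of metrics. -/
abbrev MetricJetModel : Type :=
  Model n × (SymForm (Model n) ℝ × (Model n →L[ℝ] SymForm (Model n) ℝ))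

/-- The model vector space of the fibre product. -/
abbrev MetricConnModel : Type :=
  Model n × (SymForm (Model n) ℝ × SymForm (Model n) (Model n))

/-- Smooth pseudo-Riemannian metrics of signature `(p, q)` near `x`. -/
abbrev LocalMetric (x : N) : Type _ := (metricCoords n N p q).Sec x

variable {n N p q}

/-- The value of a local metric. -/
def LocalMetric.point {x : N} (g : LocalMetric n N p q x) (y : N) : MetricPoint n N p q :=
  g.toFun y

/-- The 1-jet at `x` of a local metric. -/
def LocalMetric.jetPoint {x : N} (g : LocalMetric n N p q x) : MetricJetBundle n N p q :=
  LocalSection.jet g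

/-- `e = (g_x, Γ_x)` where `Γ_x` is the value at `x` of the Levi-Civita connection of the metric `g`,
that is, the torsion-free `∇` at `x` with `w (g (Y, Z)) = g (∇_w Y, Z) + g (Y, ∇_w Z)`. -/
structure IsLeviCivitaValue {x : N} (g : LocalMetric n N p q x)
    (e : MetricConnPoint n N p q) : Prop where
  metric_eq : e.metric = g.point x
  compatible : ∀ Y Z : VField n N, Y.DiffAt e.metric.base → Z.DiffAt e.metric.base →
    ∀ w : TangentSpace (𝓡 n) e.metric.base,
      mvfderiv (𝓡 n) (fun y => (g.point y).form (Y (g.point y).base) (Z (g.point y).base))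
          e.metric.base w =
        e.metric.form (e.conn.toFun Y w) (Z e.metric.base) +
          e.metric.form (Y e.metric.base) (e.conn.toFun Z w)

end Bundles

end

/-!
The fundamental theorem of pseudo-Riemannian geometry is algebraic on 1-jets: in a chart, a symmetric
connection with Christoffel symbols `A` satisfies the Levi-Civita condition at `x` for a metric with
components `B` and first derivatives `D` at `x` iff `D_w (u, v) = B (A (u, w), v) + B (u, A (v, w))`.
For given `B` and `A` this determines `D`, and for given nondegenerate `B` and `D` it determines `A`
by the Koszul formula (`isCompatible_iff_eq_metricDeriv`, `isCompatible_iff_eq_leviCivitaSymbols`).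
So in fibre coordinates `j¹g ↦ (g, Γ^g)` is the map `(B, D) ↦ (B, A)`, a diffeomorphism of open
sets of vector spaces (`fibreLeviCivita`).

The condition on the connection operator and the condition on the components agree in every chart
(`isLeviCivitaValue_iff_corresponds`). As the former does not refer to a chart, the fibre
diffeomorphism commutes with all coordinate changes, without any computation with the
transformation laws of derivatives and Christoffel symbols. A fibre diffeomorphism with this property
glues to a diffeomorphism of total spaces over `N` (`FibreCoords.bundleDiffeo`).

The second part holds for every diffeomorphism `f` over the base: its differential maps vertical
spaces isomorphically to vertical spaces (`verticalEquiv`), and conjugation of the connection form with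
the differential is smooth and is inverted by the same construction for the inverse of `f`
(`EhresmannConnection.bijective_pullback`).
-/

/-! ### The Christoffel symbols of a metric, algebraically -/

section Koszul

-- Instance search on iterated spaces of continuous linear maps is expensive.
set_option synthInstance.maxHeartbeats 200000

variable {E : Type*} [NormedAddCommGroup E] [NormedSpace ℝ E]

/-- The components `(B, D)` of a metric and of its first derivatives and the Christoffel symbols `A`
of a symmetric connection are compatible: `D_w (u, v) = B (A (u, w), v) + B (u, A (v, w))`. -/
def IsCompatible (B : SymForm E ℝ) (D : E →L[ℝ] SymForm E ℝ) (A : SymForm E E) : Prop :=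
  ∀ u v w, (D w).1 u v = B.1 (A.1 u w) v + B.1 u (A.1 v w)

/-- The first derivatives of the components of a metric `B` that are compatible with the
Christoffel symbols `A`: twice the symmetric part of `(u, v) ↦ B (A (u, w), v)`. -/
noncomputable def metricDeriv (B : SymForm E ℝ) (A : SymForm E E) : E →L[ℝ] SymForm E ℝ :=
  (2 : ℝ) • (symPart E ℝ).comp ((ContinuousLinearMap.compL ℝ E E (E →L[ℝ] ℝ) B.1).comp A.1)

lemma metricDeriv_apply (B : SymForm E ℝ) (A : SymForm E E) (u v w : E) :
    (metricDeriv B A w).1 u v = B.1 (A.1 u w) v + B.1 u (A.1 v w) := by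
  change (2 : ℝ) • (1 / 2 : ℝ) • (B.1 (A.1 w u) v + B.1 (A.1 w v) u) = _
  rw [A.2 w u, A.2 w v, B.2 (A.1 v w)]
  module

lemma isCompatible_iff_eq_metricDeriv {B : SymForm E ℝ} {D : E →L[ℝ] SymForm E ℝ}
    {A : SymForm E E} : IsCompatible B D A ↔ D = metricDeriv B A := by
  constructor
  · intro h
    ext1 w
    refine Subtype.ext ?_
    ext u v
    rw [h, metricDeriv_apply]
  · rintro rfl u v w
    exact metricDeriv_apply B A u v w

/-- The Christoffel symbols of the first kind,
`(u, v) ↦ (w ↦ (D_u (v, w) + D_v (u, w) - D_w (u, v)) / 2)`. -/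
noncomputable def christoffelFirst (D : E →L[ℝ] SymForm E ℝ) : E →L[ℝ] E →L[ℝ] E →L[ℝ] ℝ :=
  let T : E →L[ℝ] E →L[ℝ] E →L[ℝ] ℝ := (SymForm.toBilin E ℝ).comp D
  (1 / 2 : ℝ) • (T + T.flip -
    ((ContinuousLinearMap.flipₗᵢ ℝ E E ℝ).toContinuousLinearEquiv.toContinuousLinearMap.comp
      T.flip))

lemma christoffelFirst_apply (D : E →L[ℝ] SymForm E ℝ) (u v w : E) :
    christoffelFirst D u v w = (1 / 2 : ℝ) * ((D u).1 v w + (D v).1 u w - (D w).1 u v) := rfl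

/-- The Christoffel symbols of the second kind of a metric with components `B` and first derivatives
`D`. The inverse of `B` is a junk value unless `B` is nondegenerate. The bilinear map is already
symmetric; `symPart` only packages it as a `SymForm`. -/
noncomputable def leviCivitaSymbols (B : SymForm E ℝ) (D : E →L[ℝ] SymForm E ℝ) : SymForm E E :=
  symPart E E ((ContinuousLinearMap.compL ℝ E (E →L[ℝ] ℝ) E B.1.inverse).comp (christoffelFirst D))

variable [FiniteDimensional ℝ E] {p q : ℕ}

/-- Lowering an index with a nondegenerate form. -/
lemma exists_equiv_of_mem_pseudoForms {B : SymForm E ℝ} (hB : B ∈ pseudoForms E p q) :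
    ∃ e : E ≃L[ℝ] (E →L[ℝ] ℝ), (e : E →L[ℝ] E →L[ℝ] ℝ) = B.1 := by
  have hinj : Function.Injective (B.1 : E →ₗ[ℝ] (E →L[ℝ] ℝ)) := by
    rw [injective_iff_map_eq_zero]
    intro u hu
    exact hB.nondegenerate u fun v => congrArg (fun L : E →L[ℝ] ℝ => L v) hu
  have hrank : Module.finrank ℝ E = Module.finrank ℝ (E →L[ℝ] ℝ) := by
    rw [← (LinearMap.toContinuousLinearMap (𝕜 := ℝ) (E := E) (F' := ℝ)).finrank_eq]
    exact (Subspace.dual_finrank_eq).symm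
  exact ⟨(LinearEquiv.ofInjectiveOfFinrankEq _ hinj hrank).toContinuousLinearEquiv, rfl⟩

/-- Lowering the index of the symbols of the second kind gives those of the first kind. -/
lemma leviCivitaSymbols_spec {B : SymForm E ℝ} (hB : B ∈ pseudoForms E p q)
    (D : E →L[ℝ] SymForm E ℝ) (u v w : E) :
    B.1 ((leviCivitaSymbols B D).1 u v) w = christoffelFirst D u v w := by
  obtain ⟨e, he⟩ := exists_equiv_of_mem_pseudoForms hB
  have h : ∀ L : E →L[ℝ] ℝ, B.1 (B.1.inverse L) = L := by
    intro L
    rw [← he, ContinuousLinearMap.inverse_equiv]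
    exact e.apply_symm_apply L
  have hs : christoffelFirst D v u = christoffelFirst D u v := by
    ext w
    rw [christoffelFirst_apply, christoffelFirst_apply, (D w).2 v u]
    ring
  change B.1 ((1 / 2 : ℝ) • (B.1.inverse (christoffelFirst D u v) +
    B.1.inverse (christoffelFirst D v u))) w = _
  rw [hs, map_smul, map_add, h]
  simp
  ring

/-- The fundamental theorem of pseudo-Riemannian geometry, at the level of components: the Koszul
formula. -/
lemma isCompatible_iff_eq_leviCivitaSymbols {B : SymForm E ℝ} (hB : B ∈ pseudoForms E p q)
    {D : E →L[ℝ] SymForm E ℝ} {A : SymForm E E} :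
    IsCompatible B D A ↔ A = leviCivitaSymbols B D := by
  constructor
  · intro h
    refine Subtype.ext ?_
    ext1 u
    ext1 v
    rw [← sub_eq_zero]
    refine hB.nondegenerate _ fun w => ?_
    rw [map_sub, sub_apply, leviCivitaSymbols_spec hB, christoffelFirst_apply, h, h, h,
      A.2 v u, A.2 w u, A.2 w v, B.2 u, B.2 v]
    ring
  · rintro rfl u v w
    rw [B.2 u, leviCivitaSymbols_spec hB, leviCivitaSymbols_spec hB, christoffelFirst_apply,
      christoffelFirst_apply, (D w).2 v u, (D v).2 w u, (D u).2 w v]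
    ring

/-- The coordinate expression of `j¹g ↦ (g, Γ^g)` on the fibres over `N`: a diffeomorphism of open
subsets of vector spaces, with inverse `(B, A) ↦ (B, metricDeriv B A)`. -/
noncomputable def fibreLeviCivita (E : Type*) [NormedAddCommGroup E] [NormedSpace ℝ E]
    [FiniteDimensional ℝ E] (p q : ℕ) :
    PartialEquiv (SymForm E ℝ × (E →L[ℝ] SymForm E ℝ)) (SymForm E ℝ × SymForm E E) where
  toFun r := (r.1, leviCivitaSymbols r.1 r.2)
  invFun r := (r.1, metricDeriv r.1 r.2)
  source := pseudoForms E p q ×ˢ univ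
  target := pseudoForms E p q ×ˢ univ
  map_source' _ hr := ⟨hr.1, mem_univ _⟩
  map_target' _ hr := ⟨hr.1, mem_univ _⟩
  left_inv' _ hr := Prod.ext rfl
    (isCompatible_iff_eq_metricDeriv.1 ((isCompatible_iff_eq_leviCivitaSymbols hr.1).2 rfl)).symm
  right_inv' _ hr := Prod.ext rfl
    ((isCompatible_iff_eq_leviCivitaSymbols hr.1).1 (isCompatible_iff_eq_metricDeriv.2 rfl)).symm

lemma contDiffOn_fibreLeviCivita :
    ContDiffOn ℝ ∞ (fibreLeviCivita E p q) (fibreLeviCivita E p q).source := by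
  have : CompleteSpace E := FiniteDimensional.complete ℝ E
  have h : ContDiffOn ℝ ∞ (fun r : SymForm E ℝ × (E →L[ℝ] SymForm E ℝ) => r.1.1.inverse)
      (pseudoForms E p q ×ˢ univ) := by
    rintro r ⟨hr, -⟩
    obtain ⟨e, he⟩ := exists_equiv_of_mem_pseudoForms hr
    have h1 := contDiffAt_map_inverse (𝕜 := ℝ) (n := ∞) e
    rw [he] at h1
    exact (h1.comp r ((SymForm.toBilin E ℝ).contDiff.comp contDiff_fst).contDiffAt).contDiffWithinAt
  have h' : ∀ u v : E, ContDiff ℝ ∞ fun r : SymForm E ℝ × (E →L[ℝ] SymForm E ℝ) =>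
      christoffelFirst r.2 u v := by
    intro u v
    rw [contDiff_clm_apply_iff]
    intro w
    change ContDiff ℝ ∞ fun r : SymForm E ℝ × (E →L[ℝ] SymForm E ℝ) =>
      (1 / 2 : ℝ) * (SymForm.toBilin E ℝ (r.2 u) v w + SymForm.toBilin E ℝ (r.2 v) u w -
        SymForm.toBilin E ℝ (r.2 w) u v)
    fun_prop
  refine contDiffOn_fst.prodMk ((symPart E E).contDiff.comp_contDiffOn ?_)
  rw [contDiffOn_clm_apply]
  intro u
  rw [contDiffOn_clm_apply]
  intro v
  exact h.clm_apply (h' u v).contDiffOn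

lemma contDiffOn_fibreLeviCivita_symm :
    ContDiffOn ℝ ∞ (fibreLeviCivita E p q).symm (fibreLeviCivita E p q).target := by
  refine ContDiff.contDiffOn (contDiff_fst.prodMk (ContDiff.const_smul _ ?_))
  rw [contDiff_clm_apply_iff]
  intro w
  refine (symPart E ℝ).contDiff.comp (f := fun r : SymForm E ℝ × SymForm E E =>
    (SymForm.toBilin E ℝ r.1).comp (SymForm.toBilin E E r.2 w)) ?_
  fun_prop

end Koszul

/-! ### Bundle maps given by a fixed map of fibre coordinates -/

namespace FibreCoords

variable {n : ℕ} {N : Type*} [TopologicalSpace N] [ChartedSpace (Model n) N]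
  {V : Type*} [NormedAddCommGroup V] [NormedSpace ℝ V] {X : Type*}
  {W : Type*} [NormedAddCommGroup W] [NormedSpace ℝ W] {Y : Type*}

/-- The points `e` and `e'` lie over the same point of `N`, and `ψ` maps the coordinate of `e` to the
coordinate of `e'`, in the chart at `c`. -/
def Corresponds (F : FibreCoords n N V X) (G : FibreCoords n N W Y) (ψ : V → W) (c : N)
    (e : F.Total) (e' : G.Total) : Prop :=
  G.proj e' = F.proj e ∧ G.coord c e' = ψ (F.coord c e)

/-- The map `ψ` of fibre coordinates commutes with the coordinate changes, stated as the independence of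
`Corresponds` from the chart. -/
def IsNatural (F : FibreCoords n N V X) (G : FibreCoords n N W Y) (ψ : V → W) : Prop :=
  ∀ (c c' : N) (e : F.Total) (e' : G.Total), F.proj e ∈ (chartAt (Model n) c).source →
    F.proj e ∈ (chartAt (Model n) c').source → F.Corresponds G ψ c e e' → F.Corresponds G ψ c' e e'

variable {F : FibreCoords n N V X} {G : FibreCoords n N W Y} {ψ : PartialEquiv V W}

lemma coord_mem_fib (F : FibreCoords n N V X) {c : N} {e : F.Total}
    (he : F.proj e ∈ (chartAt (Model n) c).source) : F.coord c e ∈ F.fib :=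
  (F.bijOn c _ he).mapsTo rfl

lemma existsUnique_corresponds (hs : ψ.source = F.fib) (ht : ψ.target = G.fib) (c : N)
    (e : F.Total) (he : F.proj e ∈ (chartAt (Model n) c).source) :
    ∃! e' : G.Total, F.Corresponds G ψ c e e' := by
  have h : ψ (F.coord c e) ∈ G.fib := by
    rw [← ht]
    refine ψ.map_source ?_
    rw [hs]
    exact F.coord_mem_fib he
  obtain ⟨e', he', hc⟩ := (G.bijOn c _ he).surjOn h
  exact ⟨e', ⟨he', hc⟩, fun e'' h'' => (G.bijOn c _ he).injOn h''.1 he' (h''.2.trans hc.symm)⟩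

lemma corresponds_symm (hs : ψ.source = F.fib) (ht : ψ.target = G.fib) {c : N} {e : F.Total}
    {e' : G.Total} (he : F.proj e ∈ (chartAt (Model n) c).source) :
    G.Corresponds F ψ.symm c e' e ↔ F.Corresponds G ψ c e e' := by
  constructor
  · rintro ⟨h1, h2⟩
    refine ⟨h1.symm, ?_⟩
    rw [h2, ψ.right_inv]
    rw [ht]
    exact G.coord_mem_fib (by rwa [← h1])
  · rintro ⟨h1, h2⟩
    refine ⟨h1.symm, ?_⟩
    rw [h2, ψ.left_inv]
    rw [hs]
    exact F.coord_mem_fib he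

lemma IsNatural.symm (hs : ψ.source = F.fib) (ht : ψ.target = G.fib) (h : F.IsNatural G ψ) :
    G.IsNatural F ψ.symm := by
  intro c c' e' e hc hc' he
  have hp : F.proj e = G.proj e' := he.1
  rw [← hp] at hc hc'
  rw [corresponds_symm hs ht hc] at he
  rw [corresponds_symm hs ht hc']
  exact h c c' e e' hc hc' he

/-- The map of total spaces that is given by `ψ` in fibre coordinates. It is defined by the chart at
the base point. -/
noncomputable def bundleMap (hs : ψ.source = F.fib) (ht : ψ.target = G.fib) (e : F.Total) :
    G.Total :=
  (existsUnique_corresponds hs ht (F.proj e) e (mem_chart_source _ _)).choose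

lemma corresponds_bundleMap (hs : ψ.source = F.fib) (ht : ψ.target = G.fib)
    (h : F.IsNatural G ψ) {c : N} {e : F.Total} (he : F.proj e ∈ (chartAt (Model n) c).source) :
    F.Corresponds G ψ c e (bundleMap hs ht e) :=
  h _ _ _ _ (mem_chart_source _ _) he
    (existsUnique_corresponds hs ht (F.proj e) e (mem_chart_source _ _)).choose_spec.1

lemma bundleMap_eq_iff (hs : ψ.source = F.fib) (ht : ψ.target = G.fib)
    (h : F.IsNatural G ψ) {c : N} {e : F.Total} {e' : G.Total}
    (he : F.proj e ∈ (chartAt (Model n) c).source) :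
    bundleMap hs ht e = e' ↔ F.Corresponds G ψ c e e' := by
  constructor
  · rintro rfl
    exact corresponds_bundleMap hs ht h he
  · exact fun h' => (existsUnique_corresponds hs ht c e he).unique
      (corresponds_bundleMap hs ht h he) h'

variable [IsManifold (𝓡 n) ∞ N]

lemma contMDiff_bundleMap (hs : ψ.source = F.fib) (ht : ψ.target = G.fib)
    (h : F.IsNatural G ψ) (hψ : ContDiffOn ℝ ∞ ψ ψ.source) :
    ContMDiff 𝓘(ℝ, Model n × V) 𝓘(ℝ, Model n × W) ∞ (bundleMap (F := F) (G := G) hs ht) := by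
  intro e₀
  have hp : ∀ e : F.Total, G.proj (bundleMap hs ht e) = F.proj e := fun e =>
    (corresponds_bundleMap hs ht h (mem_chart_source _ _)).1
  have hopen : IsOpen (F.chart e₀).target :=
    (chartAt (Model n) (F.proj e₀)).open_target.prod F.isOpen_fib
  have h1 : ContMDiffOn 𝓘(ℝ, Model n × V) 𝓘(ℝ, Model n × W) ∞
      (fun r : Model n × V => (r.1, ψ r.2)) (F.chart e₀).target := by
    refine ContDiffOn.contMDiffOn (contDiffOn_fst.prodMk (hψ.comp contDiffOn_snd fun r hr => ?_))
    rw [hs]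
    exact hr.2
  have h2 := contMDiffOn_chart (I := 𝓘(ℝ, Model n × V)) (n := ∞) (x := e₀)
  have h3 := contMDiffOn_chart_symm (I := 𝓘(ℝ, Model n × W)) (n := ∞) (x := bundleMap hs ht e₀)
  have h4 : MapsTo (fun e : F.Total => ((F.chart e₀ e).1, ψ (F.chart e₀ e).2))
      (chartAt (Model n × V) e₀).source (chartAt (Model n × W) (bundleMap hs ht e₀ : G.Total)).target := by
    intro e he
    have h5 := (F.chart e₀).map_source he
    refine ⟨?_, ?_⟩
    · rw [hp]
      exact h5.1
    · rw [← ht]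
      refine ψ.map_source ?_
      rw [hs]
      exact h5.2
  have h6 := h3.comp (h1.comp h2 fun e he => (F.chart e₀).map_source he) h4
  refine (h6.congr ?_).contMDiffAt ((chartAt (Model n × V) e₀).open_source.mem_nhds
    (mem_chart_source _ e₀))
  intro e he
  have h7 : bundleMap hs ht e ∈ (chartAt (Model n × W) (bundleMap hs ht e₀ : G.Total)).source := by
    change G.proj (bundleMap hs ht e) ∈ (chartAt (Model n) (G.proj (bundleMap hs ht e₀))).source
    rw [hp, hp]
    exact he
  rw [← (chartAt (Model n × W) (bundleMap hs ht e₀ : G.Total)).left_inv h7]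
  congr 1
  change (chartAt (Model n) (G.proj (bundleMap hs ht e₀)) (G.proj (bundleMap hs ht e)),
    G.coord (G.proj (bundleMap hs ht e₀)) (bundleMap hs ht e)) =
    (chartAt (Model n) (F.proj e₀) (F.proj e), ψ (F.coord (F.proj e₀) e))
  rw [hp, hp, (corresponds_bundleMap hs ht h he).2]

/-- The diffeomorphism of total spaces that is given by a natural diffeomorphism `ψ` of the fibres. -/
noncomputable def bundleDiffeo (hs : ψ.source = F.fib) (ht : ψ.target = G.fib)
    (h : F.IsNatural G ψ) (hψ : ContDiffOn ℝ ∞ ψ ψ.source)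
    (hψ' : ContDiffOn ℝ ∞ ψ.symm ψ.target) :
    Diffeomorph 𝓘(ℝ, Model n × V) 𝓘(ℝ, Model n × W) F.Total G.Total ∞ where
  toFun := bundleMap hs ht
  invFun := bundleMap (ψ := ψ.symm) ht hs
  left_inv e := by
    have hc := corresponds_bundleMap hs ht h (mem_chart_source (Model n) (F.proj e))
    refine (bundleMap_eq_iff (ψ := ψ.symm) ht hs (h.symm hs ht) (c := F.proj e) ?_).2
      ((corresponds_symm hs ht (mem_chart_source _ _)).2 hc)
    rw [hc.1]
    exact mem_chart_source _ _
  right_inv e := by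
    have hc := corresponds_bundleMap (ψ := ψ.symm) ht hs (h.symm hs ht)
      (mem_chart_source (Model n) (G.proj e))
    have hm : F.proj (bundleMap (ψ := ψ.symm) ht hs e) ∈
        (chartAt (Model n) (G.proj e)).source := by
      rw [hc.1]
      exact mem_chart_source _ _
    exact (bundleMap_eq_iff hs ht h hm).2 ((corresponds_symm hs ht hm).1 hc)
  contMDiff_toFun := contMDiff_bundleMap hs ht h hψ
  contMDiff_invFun := contMDiff_bundleMap (ψ := ψ.symm) ht hs (h.symm hs ht) hψ'

lemma mdifferentiableAt_pr (F : FibreCoords n N V X) (e : F.Total) :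
    MDifferentiableAt 𝓘(ℝ, Model n × V) (𝓡 n) F.pr e := by
  have h1 := F.mdifferentiableAt_chart e e rfl (mem_chart_source _ _)
  have h2 : MDifferentiableAt 𝓘(ℝ, Model n × V) 𝓘(ℝ, Model n)
      (fun e' : F.Total => chartAt (Model n) (F.pr e) (F.pr e')) e :=
    MDifferentiableAt.comp e (g := (ContinuousLinearMap.fst ℝ (Model n) V))
      (ContinuousLinearMap.mdifferentiableAt _) h1
  have h3 := (mdifferentiableAt_chart_symm (mem_chart_source (Model n) (F.pr e))).comp e h2
  refine h3.congr_of_eventuallyEq ?_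
  filter_upwards [(chartAt (Model n × V) e).open_source.mem_nhds (mem_chart_source _ e)] with e' he'
  exact ((chartAt (Model n) (F.pr e)).left_inv he').symm

end FibreCoords

/-! ### Transport of Ehresmann connections along a diffeomorphism over the base -/

section Transport

variable {E H E₁ H₁ E₂ H₂ N X Y : Type*} [NormedAddCommGroup E] [NormedSpace ℝ E]
  [TopologicalSpace H] [NormedAddCommGroup E₁] [NormedSpace ℝ E₁] [TopologicalSpace H₁]
  [NormedAddCommGroup E₂] [NormedSpace ℝ E₂] [TopologicalSpace H₂]
  {I : ModelWithCorners ℝ E H} {J : ModelWithCorners ℝ E₁ H₁} {K : ModelWithCorners ℝ E₂ H₂}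
  [TopologicalSpace N] [ChartedSpace H N] [TopologicalSpace X] [ChartedSpace H₁ X]
  [TopologicalSpace Y] [ChartedSpace H₂ Y]

lemma Diffeomorph.mfderiv_symm_mfderiv (f : Diffeomorph J K X Y ∞) (x : X)
    (v : TangentSpace J x) : (mfderiv K J f.symm (f x) (mfderiv J K f x v) : E₁) = v := by
  have h := mfderiv_comp (I := J) (I' := K) (I'' := J) x (f.symm.mdifferentiable (by simp) (f x))
    (f.mdifferentiable (by simp) x)
  have h' : f.symm ∘ f = id := funext f.symm_apply_apply
  rw [h', mfderiv_id] at h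
  exact (congrArg (fun A : E₁ →L[ℝ] E₁ => A v) h).symm

lemma Diffeomorph.mfderiv_mfderiv_symm (f : Diffeomorph J K X Y ∞) (x : X)
    (w : TangentSpace K (f x)) : (mfderiv J K f x (mfderiv K J f.symm (f x) w : E₁) : E₂) = w := by
  have hf : MDifferentiableAt J K f (f.symm (f x)) := f.mdifferentiable (by simp) _
  have h := mfderiv_comp (I := K) (I' := J) (I'' := K) (f x) hf
    (f.symm.mdifferentiable (by simp) (f x))
  have h' : f ∘ f.symm = id := funext f.apply_symm_apply
  have h2 : (mfderiv J K f (f.symm (f x)) : E₁ →L[ℝ] E₂) = mfderiv J K f x := by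
    rw [f.symm_apply_apply]
  rw [h', mfderiv_id] at h
  refine Eq.trans ?_ (congrArg (fun A : E₂ →L[ℝ] E₂ => A w) h).symm
  exact (congrArg (fun A : E₁ →L[ℝ] E₂ => A (mfderiv K J f.symm (f x) w)) h2).symm

/-- The inverse of the differential of a diffeomorphism depends smoothly on the point. -/
lemma Diffeomorph.mfderiv_symm_comp_contMDiffAt [IsManifold J ∞ X] [IsManifold K ∞ Y]
    (f : Diffeomorph J K X Y ∞) (x₀ : X) :
    ContMDiffAt J 𝓘(ℝ, E₂ →L[ℝ] E₁) ∞
      (inTangentCoordinates K J f id (fun x => mfderiv K J f.symm (f x)) x₀) x₀ := by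
  have h := (ContMDiffAt.mfderiv_const (m := ∞) (f.symm.contMDiff (f x₀)) (by simp)).comp x₀
    (f.contMDiff x₀)
  refine h.congr_of_eventuallyEq (Eventually.of_forall fun x => ?_)
  -- The two sides differ by `f.symm (f x) = x` in the base points of dependent types.
  have hc : ∀ (y₀ y : X) (A : E₂ →L[ℝ] E₁), y₀ = x₀ → y = x →
      ContinuousLinearMap.inCoordinates E₂ (TangentSpace K) E₁ (TangentSpace J) (f x₀) (f x) x₀ x A =
      ContinuousLinearMap.inCoordinates E₂ (TangentSpace K) E₁ (TangentSpace J) (f x₀) (f x) y₀ y A := by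
    rintro _ _ A rfl rfl
    rfl
  exact hc _ _ _ (f.symm_apply_apply x₀) (f.symm_apply_apply x)

/-- The coordinate expression is multiplicative when the intermediate tangent space is read in one
trivialization. -/
lemma inCoordinates_tangent_comp [IsManifold J ∞ X] [IsManifold K ∞ Y] {y₀ y : Y}
    (hy : y ∈ (chartAt H₂ y₀).source) (x₀ x x₁ x' : X) (A : E₂ →L[ℝ] E₁) (B : E₁ →L[ℝ] E₂) :
    ContinuousLinearMap.inCoordinates E₁ (TangentSpace J) E₁ (TangentSpace J) x₀ x x₁ x' (A.comp B) =
      (ContinuousLinearMap.inCoordinates E₂ (TangentSpace K) E₁ (TangentSpace J) y₀ y x₁ x' A).comp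
        (ContinuousLinearMap.inCoordinates E₁ (TangentSpace J) E₂ (TangentSpace K) x₀ x y₀ y B) := by
  ext v
  have h := Trivialization.symmL_continuousLinearMapAt (R := ℝ)
    (trivializationAt E₂ (TangentSpace K) y₀) (b := y) hy
  exact congrArg (fun w => (trivializationAt E₁ (TangentSpace J) x₁).continuousLinearMapAt ℝ x' (A w))
    (h _).symm

variable {pX : X → N} {pY : Y → N}

lemma mfderiv_mem_verticalSpace_iff (f : Diffeomorph J K X Y ∞) (hp : pY ∘ f = pX)
    (hpY : ∀ y, MDifferentiableAt K I pY y) (x : X) (v : TangentSpace J x) :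
    mfderiv J K f x v ∈ VerticalSpace I K pY (f x) ↔ v ∈ VerticalSpace I J pX x := by
  have h : (mfderiv J I pX x : E₁ →L[ℝ] E) = (mfderiv K I pY (f x) : E₂ →L[ℝ] E).comp
      (mfderiv J K f x : E₁ →L[ℝ] E₂) := by
    subst hp
    exact mfderiv_comp x (hpY (f x)) (f.mdifferentiable (by simp) x)
  have h' : (mfderiv J I pX x v : E) = mfderiv K I pY (f x) (mfderiv J K f x v) :=
    congrArg (fun A : E₁ →L[ℝ] E => A v) h
  exact (Eq.congr_left h').symm

lemma mfderiv_symm_mem_verticalSpace (f : Diffeomorph J K X Y ∞) (hp : pY ∘ f = pX)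
    (hpY : ∀ y, MDifferentiableAt K I pY y) (x : X) (w : TangentSpace K (f x))
    (hw : w ∈ VerticalSpace I K pY (f x)) :
    (show TangentSpace J x from mfderiv K J f.symm (f x) w) ∈ VerticalSpace I J pX x := by
  rw [← mfderiv_mem_verticalSpace_iff f hp hpY]
  have h : mfderiv J K f x (show TangentSpace J x from mfderiv K J f.symm (f x) w) = w :=
    f.mfderiv_mfderiv_symm x w
  rwa [h]

/-- The isomorphism of vertical spaces that is induced by a diffeomorphism over `N`. -/
noncomputable def verticalEquiv (f : Diffeomorph J K X Y ∞) (hp : pY ∘ f = pX)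
    (hpY : ∀ y, MDifferentiableAt K I pY y) (x : X) :
    VerticalSpace I J pX x ≃L[ℝ] VerticalSpace I K pY (f x) where
  toFun v := ⟨mfderiv J K f x v, (mfderiv_mem_verticalSpace_iff f hp hpY x v).2 v.2⟩
  invFun w := ⟨mfderiv K J f.symm (f x) w, mfderiv_symm_mem_verticalSpace f hp hpY x w w.2⟩
  map_add' _ _ := Subtype.ext (map_add (mfderiv J K f x) _ _)
  map_smul' _ _ := Subtype.ext (map_smul (mfderiv J K f x) _ _)
  left_inv v := Subtype.ext (f.mfderiv_symm_mfderiv x v)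
  right_inv w := Subtype.ext (f.mfderiv_mfderiv_symm x w)
  continuous_toFun := ((mfderiv J K f x).continuous.comp continuous_subtype_val).subtype_mk _
  continuous_invFun :=
    ((mfderiv K J f.symm (f x)).continuous.comp continuous_subtype_val).subtype_mk _

variable [IsManifold J ∞ X] [IsManifold K ∞ Y]

/-- The connection form at a point, as an endomorphism of the model space of the tangent bundle. -/
noncomputable def EhresmannConnection.modelForm (γ : EhresmannConnection I K pY) (y : Y) : E₂ →L[ℝ] E₂ :=
  (VerticalSpace I K pY y).subtypeL.comp (γ.form y)

lemma EhresmannConnection.eq_of_modelForm {γ γ' : EhresmannConnection I K pY}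
    (h : ∀ y, γ.modelForm y = γ'.modelForm y) : γ = γ' := by
  obtain ⟨form, h1, h2⟩ := γ
  obtain ⟨form', h1', h2'⟩ := γ'
  have : form = form' := by
    funext y
    ext1 v
    exact Subtype.ext (congrArg (fun A : E₂ →L[ℝ] E₂ => A v) (h y))
  subst this
  rfl

/-- The pull-back of an Ehresmann connection along a diffeomorphism over `N`. -/
noncomputable def EhresmannConnection.pullback (f : Diffeomorph J K X Y ∞) (hp : pY ∘ f = pX)
    (hpY : ∀ y, MDifferentiableAt K I pY y) (γ : EhresmannConnection I K pY) :
    EhresmannConnection I J pX where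
  form x := ((verticalEquiv f hp hpY x).symm : VerticalSpace I K pY (f x) →L[ℝ] _).comp
    ((γ.form (f x)).comp (mfderiv J K f x))
  form_vertical x v := by
    have h : γ.form (f x) (mfderiv J K f x v) = verticalEquiv f hp hpY x v :=
      γ.form_vertical (f x) (verticalEquiv f hp hpY x v)
    change (verticalEquiv f hp hpY x).symm (γ.form (f x) (mfderiv J K f x v)) = v
    rw [h, ContinuousLinearEquiv.symm_apply_apply]
  contMDiff_form x₀ := by
    rw [contMDiffAt_hom_bundle]
    refine ⟨contMDiffAt_id, ?_⟩
    have h1 := ContMDiffAt.mfderiv_const (m := ∞) (f.contMDiff x₀) (by simp)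
    have h2 := ((contMDiffAt_hom_bundle _).1 (γ.contMDiff_form (f x₀))).2.comp x₀ (f.contMDiff x₀)
    have h3 := f.mfderiv_symm_comp_contMDiffAt x₀
    refine (h3.clm_comp (h2.clm_comp h1)).congr_of_eventuallyEq ?_
    filter_upwards [f.continuous.continuousAt.preimage_mem_nhds
      ((chartAt H₂ (f x₀)).open_source.mem_nhds (mem_chart_source _ _))] with x hx
    -- In trivializations, the form is the product of the three factors `h3`, `h2`, `h1`.
    refine (inCoordinates_tangent_comp (J := J) (K := K) (y₀ := f x₀) hx x₀ x x₀ x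
      (mfderiv K J f.symm (f x)) ((γ.modelForm (f x)).comp (mfderiv J K f x))).trans ?_
    congr 1
    ext v
    have h := Trivialization.symmL_continuousLinearMapAt (R := ℝ)
      (trivializationAt E₂ (TangentSpace K) (f x₀)) (b := f x) hx
    exact congrArg (fun w => (trivializationAt E₂ (TangentSpace K) (f x₀)).continuousLinearMapAt ℝ
      (f x) (γ.modelForm (f x) w)) (h _).symm

variable (J K) in
/-- The differential of a map, as a map of the model spaces of the tangent bundles. -/
noncomputable def modelDeriv (f : X → Y) (x : X) : E₁ →L[ℝ] E₂ := mfderiv J K f x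

lemma EhresmannConnection.modelForm_pullback (f : Diffeomorph J K X Y ∞) (hp : pY ∘ f = pX)
    (hpY : ∀ y, MDifferentiableAt K I pY y) (γ : EhresmannConnection I K pY) (x : X) :
    (γ.pullback f hp hpY).modelForm x =
      (modelDeriv K J f.symm (f x)).comp ((γ.modelForm (f x)).comp (modelDeriv J K f x)) := rfl

/-- Pull-back along a diffeomorphism over `N` is a bijection of Ehresmann connections. -/
lemma EhresmannConnection.bijective_pullback (f : Diffeomorph J K X Y ∞) (hp : pY ∘ f = pX)
    (hpX : ∀ x, MDifferentiableAt J I pX x) (hpY : ∀ y, MDifferentiableAt K I pY y) :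
    Function.Bijective (EhresmannConnection.pullback (I := I) f hp hpY) := by
  have hl : ∀ x v, modelDeriv K J f.symm (f x) (modelDeriv J K f x v) = v :=
    f.mfderiv_symm_mfderiv
  have hr : ∀ x w, modelDeriv J K f x (modelDeriv K J f.symm (f x) w) = w :=
    f.mfderiv_mfderiv_symm
  constructor
  · intro γ γ' h
    refine eq_of_modelForm fun y => ?_
    obtain ⟨x, rfl⟩ := f.surjective y
    change γ.modelForm (f x) = γ'.modelForm (f x)
    ext w
    have h1 := congrArg (fun δ => modelDeriv J K f x
      (δ.modelForm x (modelDeriv K J f.symm (f x) w))) h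
    simpa only [modelForm_pullback, ContinuousLinearMap.comp_apply, hr] using h1
  · intro δ
    have hp' : pX ∘ f.symm = pY := by
      rw [← hp]
      funext y
      exact congrArg pY (f.apply_symm_apply y)
    refine ⟨δ.pullback f.symm hp' hpX, eq_of_modelForm fun x => ?_⟩
    ext v
    -- The differential of `f.symm.symm` at `f.symm (f x)` is definitionally that of `f`.
    have h : (δ.pullback f.symm hp' hpX).modelForm (f x) =
        (modelDeriv J K f x).comp ((δ.modelForm x).comp (modelDeriv K J f.symm (f x))) := by
      rw [modelForm_pullback, f.symm_apply_apply]
      rfl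
    rw [modelForm_pullback, h]
    simp only [ContinuousLinearMap.comp_apply, hl]

end Transport

/-! ### The Levi-Civita condition in fibre coordinates -/

section LeviCivita

variable {n : ℕ} {N : Type*} [TopologicalSpace N] [ChartedSpace (Model n) N]
  [IsManifold (𝓡 n) ∞ N] {p q : ℕ}

/-- The derivative of `h ∘ φ`, where `φ` is the chart at `c`. -/
lemma mvfderiv_comp_chart {W : Type*} [NormedAddCommGroup W] [NormedSpace ℝ W] {c x : N}
    (hx : x ∈ (chartAt (Model n) c).source) {f : N → W} {h : Model n → W}
    {h' : Model n →L[ℝ] W} (hh : HasFDerivAt h h' (chartAt (Model n) c x))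
    (hf : f =ᶠ[𝓝 x] h ∘ chartAt (Model n) c) (w : TangentSpace (𝓡 n) x) :
    mvfderiv (𝓡 n) f x w = h' (toModel c x w) := by
  have hφ : MDifferentiableAt (𝓡 n) 𝓘(ℝ, Model n) (chartAt (Model n) c) x :=
    mdifferentiableAt_atlas (I := 𝓡 n) (chart_mem_atlas _ c) hx
  have hφ' : mfderiv (𝓡 n) 𝓘(ℝ, Model n) (chartAt (Model n) c) x w = toModel c x w := by
    have := TangentBundle.continuousLinearMapAt_trivializationAt (I := 𝓡 n) hx
    exact (congrArg (fun A : Model n →L[ℝ] Model n => A w) this).symm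
  have h1 : mvfderiv (𝓡 n) f x w = mvfderiv (𝓡 n) (h ∘ chartAt (Model n) c) x w :=
    congrArg (fun A : Model n →L[ℝ] W => A w) (hf.mfderiv_eq (I := 𝓡 n) (I' := 𝓘(ℝ, W)))
  have h2 : mvfderiv (𝓡 n) (h ∘ chartAt (Model n) c) x w =
      mvfderiv 𝓘(ℝ, Model n) h (chartAt (Model n) c x)
        (mfderiv (𝓡 n) 𝓘(ℝ, Model n) (chartAt (Model n) c) x w) :=
    mfderiv_comp_apply (I' := 𝓘(ℝ, Model n)) (I'' := 𝓘(ℝ, W)) x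
      hh.differentiableAt.mdifferentiableAt hφ w
  rw [h1, h2, hφ', ← hh.fderiv]
  exact congrArg (fun A : Model n →L[ℝ] W => A (toModel c x w)) mfderiv_eq_fderiv

/-- The coordinate representation of a vector field. -/
noncomputable def VField.rep (c : N) (Y : VField n N) (u : Model n) : Model n :=
  toModel c ((chartAt (Model n) c).symm u) (Y ((chartAt (Model n) c).symm u))

lemma VField.rep_chart {c y : N} (hy : y ∈ (chartAt (Model n) c).source) (Y : VField n N) :
    Y.rep c (chartAt (Model n) c y) = toModel c y (Y y) := by
  rw [VField.rep, (chartAt (Model n) c).left_inv hy]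

lemma VField.differentiableAt_rep {c x : N} (hx : x ∈ (chartAt (Model n) c).source)
    {Y : VField n N} (hY : Y.DiffAt x) :
    DifferentiableAt ℝ (Y.rep c) (chartAt (Model n) c x) := by
  rw [VField.diffAt_iff hx] at hY
  have hl := (chartAt (Model n) c).left_inv hx
  rw [← hl] at hY
  exact (hY.comp _ (FibreCoords.mdifferentiableAt_chart_symm hx)).differentiableAt

/-- A connection in terms of its Christoffel symbols. -/
lemma SymConnAt.toModel_toFun {c x : N} (hx : x ∈ (chartAt (Model n) c).source)
    (D : SymConnAt (n := n) x) {Y : VField n N} (hY : Y.DiffAt x) (w : TangentSpace (𝓡 n) x) :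
    toModel c x (D.toFun Y w) = fderiv ℝ (Y.rep c) (chartAt (Model n) c x) (toModel c x w) +
      (D.christoffel c hx).1 (toModel c x (Y x)) (toModel c x w) := by
  have h0 : D.toFun Y = SymConnAt.ofChristoffelFun c x (D.christoffel c hx) Y := by
    conv_lhs => rw [← SymConnAt.ofChristoffel_christoffel D c hx]
    rfl
  rw [h0, SymConnAt.ofChristoffelFun, if_pos hY]
  have hev : (fun y => toModel c y (Y y)) =ᶠ[𝓝 x] Y.rep c ∘ chartAt (Model n) c := by
    filter_upwards [(chartAt (Model n) c).open_source.mem_nhds hx] with y hy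
    exact (VField.rep_chart hy Y).symm
  change toModel c x (ofModel c x (mvfderiv (𝓡 n) (fun y => toModel c y (Y y)) x w + _)) = _
  rw [toModel_ofModel hx, mvfderiv_comp_chart hx
    (VField.differentiableAt_rep hx hY).hasFDerivAt hev]
  rfl

lemma MetricPoint.form_eq_coord {c : N} {m : MetricPoint n N p q}
    (hm : m.base ∈ (chartAt (Model n) c).source) (u v : TangentSpace (𝓡 n) m.base) :
    m.form u v = (m.coord c).1 (toModel c m.base u) (toModel c m.base v) := by
  rw [MetricPoint.coord_apply, ofModel_toModel hm, ofModel_toModel hm]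

lemma LocalMetric.eventually_base {x : N} (g : LocalMetric n N p q x) :
    ∀ᶠ y in 𝓝 x, (g.point y).base = y := g.eventually

/-- The product rule for `g (Y, Z)`, in the chart at `c`. -/
lemma LocalMetric.mvfderiv_form {c x : N} (hx : x ∈ (chartAt (Model n) c).source)
    (g : LocalMetric n N p q x) {Y Z : VField n N} (hY : Y.DiffAt x) (hZ : Z.DiffAt x)
    (w : TangentSpace (𝓡 n) x) :
    mvfderiv (𝓡 n) (fun y => (g.point y).form (Y (g.point y).base) (Z (g.point y).base)) x w =
      (fderiv ℝ ((metricCoords n N p q).rep c g.toFun) (chartAt (Model n) c x)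
        (toModel c x w)).1 (toModel c x (Y x)) (toModel c x (Z x)) +
      ((g.point x).coord c).1 (fderiv ℝ (Y.rep c) (chartAt (Model n) c x) (toModel c x w))
        (toModel c x (Z x)) +
      ((g.point x).coord c).1 (toModel c x (Y x))
        (fderiv ℝ (Z.rep c) (chartAt (Model n) c x) (toModel c x w)) := by
  set u₀ := chartAt (Model n) c x
  have hg := ((SymForm.toBilin (Model n) ℝ).hasFDerivAt.comp u₀
    ((metricCoords n N p q).differentiableAt_rep g hx).hasFDerivAt)
  have hYr := (VField.differentiableAt_rep hx hY).hasFDerivAt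
  have hZr := (VField.differentiableAt_rep hx hZ).hasFDerivAt
  have hd := (hg.clm_apply hYr).clm_apply hZr
  have hg0 : (metricCoords n N p q).rep c g.toFun u₀ = (g.point x).coord c := by
    rw [FibreCoords.rep, (chartAt (Model n) c).left_inv hx]
    rfl
  rw [mvfderiv_comp_chart hx hd]
  · rw [← VField.rep_chart hx Y, ← VField.rep_chart hx Z, ← hg0]
    -- The derivative of the trilinear expression, written out by the product rule.
    change ((SymForm.toBilin (Model n) ℝ ((metricCoords n N p q).rep c g.toFun u₀)) (Y.rep c u₀))
        (fderiv ℝ (Z.rep c) u₀ (toModel c x w)) +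
      ((SymForm.toBilin (Model n) ℝ ((metricCoords n N p q).rep c g.toFun u₀))
          (fderiv ℝ (Y.rep c) u₀ (toModel c x w)) +
        SymForm.toBilin (Model n) ℝ (fderiv ℝ ((metricCoords n N p q).rep c g.toFun) u₀
          (toModel c x w)) (Y.rep c u₀)) (Z.rep c u₀) = _
    rw [add_apply]
    change _ + (_ + SymForm.toBilin (Model n) ℝ (fderiv ℝ ((metricCoords n N p q).rep c g.toFun) u₀
          (toModel c x w)) (Y.rep c u₀) (Z.rep c u₀)) =
      SymForm.toBilin (Model n) ℝ (fderiv ℝ ((metricCoords n N p q).rep c g.toFun) u₀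
          (toModel c x w)) (Y.rep c u₀) (Z.rep c u₀) +
      SymForm.toBilin (Model n) ℝ ((metricCoords n N p q).rep c g.toFun u₀)
          (fderiv ℝ (Y.rep c) u₀ (toModel c x w)) (Z.rep c u₀) +
      SymForm.toBilin (Model n) ℝ ((metricCoords n N p q).rep c g.toFun u₀) (Y.rep c u₀)
        (fderiv ℝ (Z.rep c) u₀ (toModel c x w))
    ring
  · filter_upwards [(chartAt (Model n) c).open_source.mem_nhds hx, g.eventually_base] with y hy hb
    rw [MetricPoint.form_eq_coord (c := c) (by rwa [hb])]
    have hl := (chartAt (Model n) c).left_inv hy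
    simp only [Function.comp_apply, VField.rep_chart hy, FibreCoords.rep, hl]
    rw [hb]
    rfl

/-- Compatibility with the metric, in the chart at `c`: the derivatives of the fields `Y` and `Z` cancel
in the product rule, so the condition only involves the values of `Y` and `Z` at `x`, which are
arbitrary. -/
lemma isLeviCivitaValue_iff_isCompatible {c x : N} (hx : x ∈ (chartAt (Model n) c).source)
    (g : LocalMetric n N p q x) (e : MetricConnPoint n N p q) :
    IsLeviCivitaValue g e ↔ e.metric = g.point x ∧
      IsCompatible ((g.point x).coord c)
        (fderiv ℝ ((metricCoords n N p q).rep c g.toFun) (chartAt (Model n) c x))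
        (MetricConnPoint.coord c e).2 := by
  suffices h : e.metric = g.point x → ((∀ Y Z : VField n N, Y.DiffAt e.metric.base →
      Z.DiffAt e.metric.base → ∀ w : TangentSpace (𝓡 n) e.metric.base,
      mvfderiv (𝓡 n) (fun y => (g.point y).form (Y (g.point y).base) (Z (g.point y).base))
          e.metric.base w =
        e.metric.form (e.conn.toFun Y w) (Z e.metric.base) +
          e.metric.form (Y e.metric.base) (e.conn.toFun Z w)) ↔
      IsCompatible ((g.point x).coord c)
        (fderiv ℝ ((metricCoords n N p q).rep c g.toFun) (chartAt (Model n) c x))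
        (MetricConnPoint.coord c e).2) from
    ⟨fun h' => ⟨h'.1, (h h'.1).1 h'.2⟩, fun h' => ⟨h'.1, (h h'.1).2 h'.2⟩⟩
  obtain ⟨m, D⟩ := e
  intro hm
  change m = g.point x at hm
  obtain rfl : m.base = x := by
    rw [hm]
    exact g.eventually_base.self_of_nhds
  rw [← hm, MetricConnPoint.coord_of_mem D hx]
  have key : ∀ Y Z : VField n N, Y.DiffAt m.base → Z.DiffAt m.base →
      ∀ w : TangentSpace (𝓡 n) m.base,
      (mvfderiv (𝓡 n) (fun y => (g.point y).form (Y (g.point y).base) (Z (g.point y).base))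
          m.base w =
        m.form (D.toFun Y w) (Z m.base) + m.form (Y m.base) (D.toFun Z w) ↔
      (fderiv ℝ ((metricCoords n N p q).rep c g.toFun) (chartAt (Model n) c m.base)
        (toModel c m.base w)).1 (toModel c m.base (Y m.base)) (toModel c m.base (Z m.base)) =
      (m.coord c).1 ((D.christoffel c hx).1 (toModel c m.base (Y m.base)) (toModel c m.base w))
        (toModel c m.base (Z m.base)) +
      (m.coord c).1 (toModel c m.base (Y m.base))
        ((D.christoffel c hx).1 (toModel c m.base (Z m.base)) (toModel c m.base w))) := by
    intro Y Z hY hZ w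
    rw [g.mvfderiv_form hx hY hZ, ← hm, MetricPoint.form_eq_coord hx, MetricPoint.form_eq_coord hx,
      D.toModel_toFun hx hY, D.toModel_toFun hx hZ, map_add, map_add, add_apply]
    constructor <;> intro h <;> linarith
  constructor
  · intro h u v w
    have h1 := (key _ _ (diffAt_coordField hx u) (diffAt_coordField hx v)
      (ofModel c m.base w)).1 (h _ _ (diffAt_coordField hx u) (diffAt_coordField hx v) _)
    have h2 : ∀ v, toModel c m.base (coordField c v m.base) = v := toModel_ofModel hx
    simpa only [h2, toModel_ofModel hx] using h1
  · intro h Y Z hY hZ w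
    exact (key Y Z hY hZ w).2 (h _ _ _)

/-- A point of the fibre product is the value of the Levi-Civita connection of `g` iff its coordinates
are the image of those of the jet of `g`, in any chart. -/
lemma isLeviCivitaValue_iff_corresponds {c x : N} (hx : x ∈ (chartAt (Model n) c).source)
    (g : LocalMetric n N p q x) (e : MetricConnBundle n N p q) :
    IsLeviCivitaValue g e ↔ (metricCoords n N p q).jetCoords.Corresponds (metricConnCoords n N p q)
      (fibreLeviCivita (Model n) p q) c g.jetPoint e := by
  have hb : (g.point x).base = x := g.eventually_base.self_of_nhds
  have hc : (g.point x).coord c ∈ pseudoForms (Model n) p q :=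
    (MetricPoint.bijOn_coord c x hx).mapsTo hb
  refine (isLeviCivitaValue_iff_isCompatible hx g e).trans ?_
  rw [isCompatible_iff_eq_leviCivitaSymbols hc]
  have hj : (metricCoords n N p q).jetCoords.coord c g.jetPoint = ((g.point x).coord c,
      fderiv ℝ ((metricCoords n N p q).rep c g.toFun) (chartAt (Model n) c x)) :=
    (metricCoords n N p q).jetCoord_jet g hx
  rw [FibreCoords.Corresponds, hj]
  constructor
  · rintro ⟨h1, h2⟩
    refine ⟨(congrArg MetricPoint.base h1).trans hb, Prod.ext ?_ h2⟩
    exact congrArg (MetricPoint.coord c) h1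
  · rintro ⟨h1, h2⟩
    exact ⟨(MetricPoint.bijOn_coord c x hx).injOn h1 hb (congrArg Prod.fst h2),
      congrArg Prod.snd h2⟩

/-- The coordinate expression of `j¹g ↦ (g, Γ^g)` commutes with the coordinate changes, since the
Levi-Civita condition does not refer to a chart. -/
lemma isNatural_fibreLeviCivita : (metricCoords n N p q).jetCoords.IsNatural
    (metricConnCoords n N p q) (fibreLeviCivita (Model n) p q) := by
  intro c c' j e hc hc' h
  induction j using (metricCoords n N p q).jet_ind with
  | h x g =>
    exact (isLeviCivitaValue_iff_corresponds hc' g e).1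
      ((isLeviCivitaValue_iff_corresponds hc g e).2 h)

variable (n N p q) in
/-- The diffeomorphism `j¹g ↦ (g, Γ^g)`. -/
noncomputable def leviCivitaDiffeo :
    Diffeomorph 𝓘(ℝ, MetricJetModel n) 𝓘(ℝ, MetricConnModel n)
      (MetricJetBundle n N p q) (MetricConnBundle n N p q) ∞ :=
  FibreCoords.bundleDiffeo (F := (metricCoords n N p q).jetCoords) (G := metricConnCoords n N p q)
    (ψ := fibreLeviCivita (Model n) p q) rfl rfl isNatural_fibreLeviCivita
    contDiffOn_fibreLeviCivita contDiffOn_fibreLeviCivita_symm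

lemma leviCivitaDiffeo_jetPoint_eq_iff {x : N} (g : LocalMetric n N p q x)
    (e : MetricConnBundle n N p q) :
    leviCivitaDiffeo n N p q g.jetPoint = e ↔ IsLeviCivitaValue g e :=
  (FibreCoords.bundleMap_eq_iff rfl rfl isNatural_fibreLeviCivita (mem_chart_source _ x)).trans
    (isLeviCivitaValue_iff_corresponds (mem_chart_source _ x) g e).symm

lemma pr_comp_leviCivitaDiffeo : (metricConnCoords n N p q).pr ∘ leviCivitaDiffeo n N p q =
    (metricCoords n N p q).jetCoords.pr := by
  funext j
  exact (FibreCoords.corresponds_bundleMap (F := (metricCoords n N p q).jetCoords)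
    (G := metricConnCoords n N p q) (ψ := fibreLeviCivita (Model n) p q) rfl rfl
    isNatural_fibreLeviCivita (mem_chart_source (Model n) _)).1

end LeviCivita

/-! ### First- and second-order connections -/

theorem mainTheorem3 (n p q : ℕ) (hpq : p + q = n) (N : Type*) [TopologicalSpace N]
    [T2Space N] [SecondCountableTopology N] [ChartedSpace (EuclideanSpace ℝ (Fin n)) N]
    [IsManifold (𝓡 n) ∞ N] :
    ∃ ζ : Diffeomorph 𝓘(ℝ, MetricJetModel n) 𝓘(ℝ, MetricConnModel n)
        (MetricJetBundle n N p q) (MetricConnBundle n N p q) ∞,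
      (∀ (x : N) (g : LocalMetric n N p q x) (e : MetricConnBundle n N p q),
        ζ g.jetPoint = e ↔ IsLeviCivitaValue g e) ∧
      ∃ ζv : ∀ j : MetricJetBundle n N p q,
          VerticalSpace (𝓡 n) 𝓘(ℝ, MetricJetModel n) (metricCoords n N p q).jetCoords.pr j ≃L[ℝ]
            VerticalSpace (𝓡 n) 𝓘(ℝ, MetricConnModel n) (metricConnCoords n N p q).pr (ζ j),
        (∀ j w, (ζv j w : TangentSpace 𝓘(ℝ, MetricConnModel n) (ζ j)) =
          mfderiv 𝓘(ℝ, MetricJetModel n) 𝓘(ℝ, MetricConnModel n) ζ j w) ∧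
        ∃ Φ : EhresmannConnection (𝓡 n) 𝓘(ℝ, MetricConnModel n) (metricConnCoords n N p q).pr ≃
            EhresmannConnection (𝓡 n) 𝓘(ℝ, MetricJetModel n) (metricCoords n N p q).jetCoords.pr,
          ∀ γ j X, (Φ γ).form j X = (ζv j).symm (γ.form (ζ j)
            (mfderiv 𝓘(ℝ, MetricJetModel n) 𝓘(ℝ, MetricConnModel n) ζ j X)) := by
  have hpX := (metricCoords n N p q).jetCoords.mdifferentiableAt_pr
  have hpY := (metricConnCoords n N p q).mdifferentiableAt_pr
  exact ⟨leviCivitaDiffeo n N p q, fun x g e => leviCivitaDiffeo_jetPoint_eq_iff g e,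
    verticalEquiv (leviCivitaDiffeo n N p q) pr_comp_leviCivitaDiffeo hpY, fun j w => rfl,
    Equiv.ofBijective _ (EhresmannConnection.bijective_pullback (leviCivitaDiffeo n N p q)
      pr_comp_leviCivitaDiffeo hpX hpY), fun γ j X => rfl⟩
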